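/- Let $L\subset\mathbb R^2$ be a line through the origin and let $q\in W^{1,2}_{\mathrm{loc}}(\mathbb R^2)$, $q\not\equiv 0$, satisfy in the sense of distributions $$ \Delta q\le 0,\quad q\,\Delta q=0\ \text{ in }\mathbb R^2,\qquad \Delta q=0\ \text{ in }\mathbb R^2\setminus L, $$ where $q\Delta q$ denotes the distribution $\operatorname{div}(q\nabla q)-|\nabla q|^2$, i.e. $\langle q\Delta q,\varphi\rangle=-\int \nabla q\cdot\nabla(q\varphi)$ for $\varphi\in C_c^\infty(\mathbb R^2)$. (No sign of $q$ on $L$ is assumed.) Suppose that $q$ is even with respect to $L$, i.e. invariant under the orthogonal reflection across $L$, and homogeneous of degree $\lambda\in\mathbb R$, i.e. $q(tx)=t^{\lambda}q(x)$ for all $t>0$ (both identities holding for almost every $x$). Then $$ \lambda\in\{k/2 : k=1,2,3,\dots\}, $$ except in the trivial case in which $\lambda=0$ and $q$ is (a.e. equal to) a constant. -/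

import Mathlib

open MeasureTheory
open scoped ContDiff

/-- `φ ∈ C_c^∞(ℝⁿ)`. -/
structure IsTestFun {n : ℕ} (φ : EuclideanSpace ℝ (Fin n) → ℝ) : Prop where
  smooth : ContDiff ℝ ∞ φ
  compact_support : HasCompactSupport φ

/-- `f ∈ L²_loc(ℝⁿ; F)`. -/
def LocallyL2 {n : ℕ} {F : Type*} [NormedAddCommGroup F]
    (f : EuclideanSpace ℝ (Fin n) → F) : Prop :=
  ∀ K : Set (EuclideanSpace ℝ (Fin n)), IsCompact K → MemLp f 2 (volume.restrict K)

/-- `q ∈ W^{1,2}_loc(ℝⁿ)` with weak gradient `G`. -/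
structure IsLocalSobolev {n : ℕ} (q : EuclideanSpace ℝ (Fin n) → ℝ)
    (G : EuclideanSpace ℝ (Fin n) → EuclideanSpace ℝ (Fin n)) : Prop where
  memL2 : LocallyL2 q
  grad_memL2 : LocallyL2 G
  weak_grad : ∀ φ : EuclideanSpace ℝ (Fin n) → ℝ, IsTestFun φ →
    ∀ v : EuclideanSpace ℝ (Fin n),
      ∫ x, q x * fderiv ℝ φ x v = -∫ x, φ x * inner ℝ (G x) v

/-- The distributional Laplacian `⟨Δq, φ⟩ = ∫ q Δφ`. -/
noncomputable def distLaplacian {n : ℕ} (q φ : EuclideanSpace ℝ (Fin n) → ℝ) : ℝ :=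
  ∫ x, q x * Laplacian.laplacian φ x

/-- The distribution `qΔq = div (q∇q) - |∇q|²` of a function `q ∈ W^{1,2}_loc` with weak
gradient `G`, that is
`⟨qΔq, φ⟩ = ⟨Δq, qφ⟩ = -∫ ∇q · ∇(qφ) = -∫ (φ |∇q|² + q ∇q · ∇φ)`. -/
noncomputable def distMulLaplacian {n : ℕ} (q : EuclideanSpace ℝ (Fin n) → ℝ)
    (G : EuclideanSpace ℝ (Fin n) → EuclideanSpace ℝ (Fin n))
    (φ : EuclideanSpace ℝ (Fin n) → ℝ) : ℝ :=
  -∫ x, (φ x * ‖G x‖ ^ 2 + q x * inner ℝ (G x) (gradient φ x))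

/-- `q` is a (weak, `W^{1,2}_loc`) solution of
`Δq ≤ 0`, `qΔq = 0` in `ℝⁿ`, `Δq = 0` in `ℝⁿ \ L`. No sign of `q` on `L` is required. -/
def IsNoSignThinSolution {n : ℕ} (L : Submodule ℝ (EuclideanSpace ℝ (Fin n)))
    (q : EuclideanSpace ℝ (Fin n) → ℝ) : Prop :=
  ∃ G : EuclideanSpace ℝ (Fin n) → EuclideanSpace ℝ (Fin n),
    IsLocalSobolev q G ∧
    (∀ φ : EuclideanSpace ℝ (Fin n) → ℝ, IsTestFun φ → (∀ x, 0 ≤ φ x) →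
      distLaplacian q φ ≤ 0) ∧
    (∀ φ : EuclideanSpace ℝ (Fin n) → ℝ, IsTestFun φ → distMulLaplacian q G φ = 0) ∧
    (∀ φ : EuclideanSpace ℝ (Fin n) → ℝ, IsTestFun φ →
      tsupport φ ⊆ (L : Set (EuclideanSpace ℝ (Fin n)))ᶜ → distLaplacian q φ = 0)

/-- `q` is positively homogeneous of degree `a`, as an almost everywhere defined function:
`q(tx) = t^a q(x)` for all `t > 0`. -/
def IsHomogeneousOfDegree {n : ℕ} (a : ℝ) (q : EuclideanSpace ℝ (Fin n) → ℝ) : Prop :=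
  ∀ t : ℝ, 0 < t → ∀ᵐ x, q (t • x) = t ^ a * q x

/-- `q` is even with respect to the subspace `L`: it is invariant (almost everywhere) under the
orthogonal reflection across `L`. -/
def IsEvenSymmetric {n : ℕ} (L : Submodule ℝ (EuclideanSpace ℝ (Fin n)))
    (q : EuclideanSpace ℝ (Fin n) → ℝ) : Prop :=
  ∀ᵐ x, q (L.reflection x) = q x

/-! In logarithmic polar coordinates x = e^{s+iθ}, with `L` as the real axis, homogeneity of degree
a turns q into e^{as} g(θ), and harmonicity off `L` becomes g'' + a²g = 0 on (0, π). Above the line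
the profile is therefore k(θ) = A cos(aθ) + B sin(aθ)/a, with Bθ as second term when a = 0; below
the line evenness gives k(-θ). Along the positive half-line q has trace e^{as}A, while Δq is carried
by the jump 2B of the angular derivative, so qΔq = 0 says AB = 0. Along the negative half-line it
says k(π)k'(π) = 0. For a ≠ 0 the first condition leaves a pure cosine or a pure sine, and the
second then reads sin(aπ)cos(aπ) = 0, that is, 2a ∈ ℤ.

The sign of a comes from finite energy at the origin. The energy density in (s, θ) is e^{2as}(a²k² +
k'²), and a²k² + k'² is the conserved quantity a²A² + B². If a ≤ 0, integrability as s → -∞ forces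
it to vanish: then q = 0 when a < 0, which is excluded, and q is constant when a = 0.

Everything is carried out weakly. `IsStripSolution.exists_profile` produces A and B,
`IsStripSolution.mul_eq_zero` gives AB = 0, and `IsStripSolution.energy_eq_zero` handles a ≤ 0. The
chart is slit along the negative half-line, so `IsStripSolution.mul_eq_zero` is used a second time
in the mirrored chart, and `oscProfile_eqOn_unique` translates the result back. -/

open Set Filter Topology

local notation "𝔼" => EuclideanSpace ℝ (Fin 2)

/-! ### Logarithmic polar coordinates and change of variables -/

/-- The open strip `ℝ × (-π, π)` of logarithmic polar coordinates. -/
def logStrip : Set (ℝ × ℝ) := univ ×ˢ Ioo (-Real.pi) Real.pi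

/-- Logarithmic polar coordinates `(s, θ) ↦ e^{s + iθ}` on a Euclidean plane identified
with `ℂ`. -/
noncomputable def logChart (Ψ : 𝔼 ≃ₗᵢ[ℝ] ℂ) (y : ℝ × ℝ) : 𝔼 :=
  Ψ.symm (Complex.exp (y.1 + y.2 * Complex.I))

theorem mem_logStrip {y : ℝ × ℝ} : y ∈ logStrip ↔ -Real.pi < y.2 ∧ y.2 < Real.pi := by
  simp [logStrip]

theorem isOpen_logStrip : IsOpen logStrip := isOpen_univ.prod isOpen_Ioo

theorem Complex.image_exp_strip :
    Complex.exp '' {z | z.im ∈ Ioo (-Real.pi) Real.pi} = Complex.slitPlane :=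
  Complex.expOpenPartialHomeomorph.image_source_eq_target

theorem Complex.injOn_exp_strip : InjOn Complex.exp {z | z.im ∈ Ioo (-Real.pi) Real.pi} :=
  Complex.expOpenPartialHomeomorph.injOn

/-- The determinant of multiplication by `w` is the field norm of ℂ over ℝ. With `w = exp z` it is
the Jacobian of the exponential. -/
theorem Complex.det_mul_real (w : ℂ) :
    (w • (1 : ℂ →L[ℝ] ℂ)).det = Complex.normSq w := by
  have h := congrArg (fun f => f w) Algebra.norm_complex_eq
  simp only [Algebra.norm_apply] at h
  rw [← show _ = Complex.normSq w from h]
  congr 1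

theorem Complex.slitPlane_ae_eq_univ : (Complex.slitPlane : Set ℂ) =ᵐ[volume] (univ : Set ℂ) := by
  have h := Complex.volume_preserving_equiv_real_prod.quasiMeasurePreserving.preimage_ae_eq
    polarCoord_source_ae_eq_univ
  exact h

theorem measurePreserving_toComplex :
    MeasurePreserving (fun y : ℝ × ℝ => (y.1 + y.2 * Complex.I : ℂ)) := by
  have h := Complex.volume_preserving_equiv_real_prod.symm
  convert! h using 2 with y
  simp [Complex.ext_iff]

theorem measurableEmbedding_toComplex :
    MeasurableEmbedding (fun y : ℝ × ℝ => (y.1 + y.2 * Complex.I : ℂ)) := by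
  convert! Complex.measurableEquivRealProd.symm.measurableEmbedding using 2 with y
  simp [Complex.ext_iff]

section ChangeOfVariables

variable (Ψ : 𝔼 ≃ₗᵢ[ℝ] ℂ)

theorem continuous_logChart : Continuous (logChart Ψ) := by
  unfold logChart; fun_prop

theorem Complex.normSq_exp_add_mul_I (y : ℝ × ℝ) :
    Complex.normSq (Complex.exp (y.1 + y.2 * Complex.I)) = Real.exp (2 * y.1) := by
  rw [Complex.normSq_eq_norm_sq, Complex.norm_exp, ← Real.exp_nat_mul]
  simp

theorem Complex.hasFDerivWithinAt_exp_real (s : Set ℂ) (z : ℂ) :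
    HasFDerivWithinAt Complex.exp (Complex.exp z • (1 : ℂ →L[ℝ] ℂ)) s z :=
  ((Complex.hasStrictFDerivAt_exp_real z).hasFDerivAt).hasFDerivWithinAt

/-- The exponential maps the strip bijectively onto the slit plane, which has full measure, with
Jacobian |e^{s+iθ}|² = e^{2s}. -/
theorem integral_logChart {F : Type*} [NormedAddCommGroup F] [NormedSpace ℝ F] (f : 𝔼 → F) :
    ∫ x, f x = ∫ y in logStrip, Real.exp (2 * y.1) • f (logChart Ψ y) := by
  have h1 : ∫ x, f x = ∫ z : ℂ, f (Ψ.symm z) :=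
    (Ψ.symm.measurePreserving.integral_comp Ψ.symm.toHomeomorph.measurableEmbedding f).symm
  have hm : MeasurableSet {z : ℂ | z.im ∈ Ioo (-Real.pi) Real.pi} :=
    Complex.measurable_im measurableSet_Ioo
  have h2 := integral_image_eq_integral_abs_det_fderiv_smul volume hm
    (fun z _ => Complex.hasFDerivWithinAt_exp_real _ z) Complex.injOn_exp_strip
    (fun z => f (Ψ.symm z))
  rw [Complex.image_exp_strip, setIntegral_congr_set Complex.slitPlane_ae_eq_univ,
    setIntegral_univ] at h2
  rw [h1, h2, ← measurePreserving_toComplex.setIntegral_preimage_emb measurableEmbedding_toComplex]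
  have : (fun y : ℝ × ℝ => (y.1 + y.2 * Complex.I : ℂ)) ⁻¹'
      {z : ℂ | z.im ∈ Ioo (-Real.pi) Real.pi} = logStrip := by
    ext y; simp [logStrip]
  rw [this]
  refine setIntegral_congr_fun isOpen_logStrip.measurableSet fun y _ => ?_
  simp only [Complex.det_mul_real, Complex.normSq_exp_add_mul_I, abs_of_pos (Real.exp_pos _)]
  rfl

theorem integrableOn_image_logChart {F : Type*} [NormedAddCommGroup F] [NormedSpace ℝ F]
    {s : Set (ℝ × ℝ)} (hs : MeasurableSet s) (hss : s ⊆ logStrip) (f : 𝔼 → F) :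
    IntegrableOn f (logChart Ψ '' s) ↔
      IntegrableOn (fun y => Real.exp (2 * y.1) • f (logChart Ψ y)) s := by
  set T : ℝ × ℝ → ℂ := fun y => (y.1 + y.2 * Complex.I : ℂ) with hT
  have hm : MeasurableSet (T '' s) := measurableEmbedding_toComplex.measurableSet_image.2 hs
  have hsub : T '' s ⊆ {z : ℂ | z.im ∈ Ioo (-Real.pi) Real.pi} := by
    rintro _ ⟨y, hy, rfl⟩
    simpa [hT] using mem_logStrip.1 (hss hy)
  have h1 : logChart Ψ '' s = Ψ.symm '' (Complex.exp '' (T '' s)) := by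
    simp only [image_image]; rfl
  rw [h1, Ψ.symm.measurePreserving.integrableOn_image Ψ.symm.toHomeomorph.measurableEmbedding,
    integrableOn_image_iff_integrableOn_abs_det_fderiv_smul volume hm
    (fun z _ => Complex.hasFDerivWithinAt_exp_real _ z) (Complex.injOn_exp_strip.mono hsub),
    measurePreserving_toComplex.integrableOn_image measurableEmbedding_toComplex]
  refine integrableOn_congr_fun (fun y _ => ?_) hs
  simp only [Complex.det_mul_real, Function.comp, Complex.normSq_exp_add_mul_I,
    abs_of_pos (Real.exp_pos _)]
  rfl

theorem map_logChart :
    Measure.map (logChart Ψ) ((volume.restrict logStrip).withDensity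
      fun y => ENNReal.ofReal (Real.exp (2 * y.1))) = volume := by
  refine Measure.ext fun s hs => ?_
  have hm : MeasurableSet {z : ℂ | z.im ∈ Ioo (-Real.pi) Real.pi} :=
    Complex.measurable_im measurableSet_Ioo
  rw [Measure.map_apply (continuous_logChart Ψ).measurable hs,
    withDensity_apply _ ((continuous_logChart Ψ).measurable hs),
    Measure.restrict_restrict ((continuous_logChart Ψ).measurable hs),
    ← Ψ.symm.measurePreserving.measure_preimage hs.nullMeasurableSet,
    ← lintegral_indicator_one (Ψ.symm.continuous.measurable hs),
    ← setLIntegral_univ (μ := (volume : Measure ℂ)), ← setLIntegral_congr Complex.slitPlane_ae_eq_univ,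
    ← Complex.image_exp_strip,
    lintegral_image_eq_lintegral_abs_det_fderiv_mul volume hm
    (fun z _ => Complex.hasFDerivWithinAt_exp_real _ z) Complex.injOn_exp_strip,
    ← measurePreserving_toComplex.setLIntegral_comp_preimage_emb measurableEmbedding_toComplex]
  have : (fun y : ℝ × ℝ => (y.1 + y.2 * Complex.I : ℂ)) ⁻¹'
      {z : ℂ | z.im ∈ Ioo (-Real.pi) Real.pi} = logStrip := by
    ext y; simp [logStrip]
  rw [this, ← setLIntegral_indicator ((continuous_logChart Ψ).measurable hs)]
  refine setLIntegral_congr_fun isOpen_logStrip.measurableSet fun y _ => ?_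
  simp only [Complex.det_mul_real, Complex.normSq_exp_add_mul_I, abs_of_pos (Real.exp_pos _)]
  by_cases h : logChart Ψ y ∈ s
  · rw [indicator_of_mem (by exact h), indicator_of_mem (by exact h)]; simp
  · rw [indicator_of_notMem (by exact h), indicator_of_notMem (by exact h)]; simp

/-- The density e^{2s} is positive, so null sets correspond in both directions. -/
theorem ae_logChart_iff {p : 𝔼 → Prop} (hp : MeasurableSet {x | p x}) :
    (∀ᵐ x, p x) ↔ ∀ᵐ y ∂volume.restrict logStrip, p (logChart Ψ y) := by
  rw [← map_logChart Ψ, ae_map_iff (continuous_logChart Ψ).aemeasurable hp,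
    ae_withDensity_iff (by fun_prop)]
  simp [Real.exp_pos]

theorem quasiMeasurePreserving_logChart :
    Measure.QuasiMeasurePreserving (logChart Ψ) (volume.restrict logStrip) volume := by
  refine ⟨(continuous_logChart Ψ).measurable, ?_⟩
  refine Measure.AbsolutelyContinuous.mk fun s hs h0 => ?_
  rw [Measure.map_apply (continuous_logChart Ψ).measurable hs]
  have := (ae_logChart_iff Ψ (p := fun x => x ∉ s) hs.compl).1 (measure_eq_zero_iff_ae_notMem.1 h0)
  exact measure_eq_zero_iff_ae_notMem.2 this

end ChangeOfVariables

/-! ### Transport of test functions from the strip to the plane -/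

/-- `Φ ∈ C_c^∞(U)`. -/
structure IsTestOn {E : Type*} [NormedAddCommGroup E] [NormedSpace ℝ E] (U : Set E)
    (Φ : E → ℝ) : Prop where
  smooth : ContDiff ℝ ∞ Φ
  compact_support : HasCompactSupport Φ
  tsupport_subset : tsupport Φ ⊆ U

section PushForward

variable (Ψ : 𝔼 ≃ₗᵢ[ℝ] ℂ) {Φ : ℝ × ℝ → ℝ}

/-- The function on the plane which is `Φ` in logarithmic polar coordinates, extended by zero. -/
noncomputable def logPush (Φ : ℝ × ℝ → ℝ) (x : 𝔼) : ℝ :=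
  Complex.slitPlane.indicator
    (fun z => Φ ((Complex.log z).re, (Complex.log z).im)) (Ψ x)

theorem log_exp_strip {y : ℝ × ℝ} (hy : y ∈ logStrip) :
    Complex.log (Complex.exp (y.1 + y.2 * Complex.I)) = y.1 + y.2 * Complex.I := by
  rw [mem_logStrip] at hy
  apply Complex.log_exp <;> simp [hy.1, hy.2.le]

theorem exp_mem_slitPlane {y : ℝ × ℝ} (hy : y ∈ logStrip) :
    Complex.exp (y.1 + y.2 * Complex.I) ∈ Complex.slitPlane := by
  rw [← Complex.image_exp_strip]
  refine mem_image_of_mem _ ?_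
  simpa using mem_logStrip.1 hy

theorem logPush_logChart (Φ : ℝ × ℝ → ℝ) {y : ℝ × ℝ} (hy : y ∈ logStrip) :
    logPush Ψ Φ (logChart Ψ y) = Φ y := by
  unfold logPush logChart
  rw [LinearIsometryEquiv.apply_symm_apply, indicator_of_mem (exp_mem_slitPlane hy),
    log_exp_strip hy]
  simp

theorem support_logPush_subset (Φ : ℝ × ℝ → ℝ) :
    Function.support (logPush Ψ Φ) ⊆ logChart Ψ '' tsupport Φ := by
  intro x hx
  have h1 : Ψ x ∈ Complex.slitPlane := by
    by_contra h
    exact hx (indicator_of_notMem h _)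
  refine ⟨((Complex.log (Ψ x)).re, (Complex.log (Ψ x)).im), subset_tsupport _ ?_, ?_⟩
  · intro h
    apply hx
    rw [logPush, indicator_of_mem h1, h]
  · simp [logChart, Complex.re_add_im, Complex.exp_log (Complex.slitPlane_ne_zero h1)]

theorem tsupport_logPush_subset (h : HasCompactSupport Φ) :
    tsupport (logPush Ψ Φ) ⊆ logChart Ψ '' tsupport Φ :=
  closure_minimal (support_logPush_subset Ψ Φ)
    (h.isCompact.image (continuous_logChart Ψ)).isClosed

/-- On the slit plane this is a composition with the smooth logarithm. Elsewhere the function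
vanishes nearby, since its support lies in the image of a compact subset of the open strip, away
from the slit and the origin. -/
theorem isTestFun_logPush (h : IsTestOn logStrip Φ) : IsTestFun (logPush Ψ Φ) := by
  refine ⟨contDiff_iff_contDiffAt.2 fun x => ?_, HasCompactSupport.of_support_subset_isCompact
    (h.compact_support.isCompact.image (continuous_logChart Ψ)) (support_logPush_subset Ψ Φ)⟩
  by_cases hx : Ψ x ∈ Complex.slitPlane
  · have h1 : logPush Ψ Φ =ᶠ[𝓝 x]
        fun x => Φ ((Complex.log (Ψ x)).re, (Complex.log (Ψ x)).im) := by
      filter_upwards [Ψ.continuous.continuousAt.preimage_mem_nhds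
        (Complex.isOpen_slitPlane.mem_nhds hx)] with z hz
      exact indicator_of_mem (s := Complex.slitPlane) hz _
    refine ContDiffAt.congr_of_eventuallyEq ?_ h1
    have h2 : ContDiffAt ℝ ∞ (fun x => Complex.log (Ψ x)) x :=
      ((Complex.contDiffAt_log (n := ∞) hx).restrict_scalars ℝ).comp x Ψ.contDiff.contDiffAt
    have h3 : ContDiffAt ℝ ∞ (fun x => (Complex.log (Ψ x)).re) x :=
      Complex.reCLM.contDiff.contDiffAt.comp x h2
    have h4 : ContDiffAt ℝ ∞ (fun x => (Complex.log (Ψ x)).im) x :=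
      Complex.imCLM.contDiff.contDiffAt.comp x h2
    exact h.smooth.contDiffAt.comp x (h3.prodMk h4)
  · have h0 : x ∉ tsupport (logPush Ψ Φ) := by
      intro h'
      obtain ⟨y, hy, rfl⟩ := tsupport_logPush_subset Ψ h.compact_support h'
      exact hx (by simpa [logChart] using exp_mem_slitPlane (h.tsupport_subset hy))
    have h1 : logPush Ψ Φ =ᶠ[𝓝 x] fun _ => 0 := notMem_tsupport_iff_eventuallyEq.1 h0
    exact contDiffAt_const.congr_of_eventuallyEq h1

theorem hasFDerivAt_logChart (y : ℝ × ℝ) :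
    HasFDerivAt (logChart Ψ) ((Ψ.symm.toContinuousLinearEquiv : ℂ →L[ℝ] 𝔼) ∘L
      ((Complex.exp (y.1 + y.2 * Complex.I) • (1 : ℂ →L[ℝ] ℂ)) ∘L
        (Complex.ofRealCLM ∘L ContinuousLinearMap.fst ℝ ℝ ℝ +
          Complex.I • (Complex.ofRealCLM ∘L ContinuousLinearMap.snd ℝ ℝ ℝ)))) y := by
  refine HasFDerivAt.comp y (Ψ.symm.toContinuousLinearEquiv.hasFDerivAt) ?_
  refine HasFDerivAt.comp y (Complex.hasStrictFDerivAt_exp_real _).hasFDerivAt ?_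
  convert! (Complex.ofRealCLM ∘L ContinuousLinearMap.fst ℝ ℝ ℝ +
    Complex.I • (Complex.ofRealCLM ∘L ContinuousLinearMap.snd ℝ ℝ ℝ)).hasFDerivAt using 2 with y
  simp [mul_comm]

theorem fderiv_logPush (h : IsTestOn logStrip Φ) {y : ℝ × ℝ} (hy : y ∈ logStrip) (w : ℝ × ℝ) :
    fderiv ℝ (logPush Ψ Φ) (logChart Ψ y)
      (Ψ.symm (Complex.exp (y.1 + y.2 * Complex.I) * (w.1 + w.2 * Complex.I))) =
      fderiv ℝ Φ y w := by
  have h1 : logPush Ψ Φ ∘ logChart Ψ =ᶠ[𝓝 y] Φ := by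
    filter_upwards [isOpen_logStrip.mem_nhds hy] with z hz using logPush_logChart Ψ Φ hz
  rw [← h1.fderiv_eq, fderiv_comp _
    ((isTestFun_logPush Ψ h).smooth.differentiable (by simp)).differentiableAt
    (hasFDerivAt_logChart Ψ y).differentiableAt, (hasFDerivAt_logChart Ψ y).fderiv]
  rw [mul_add, map_add, map_add, mul_comm (w.2 : ℂ)]
  simp

/-- Components of the constant vector c + di in the moving frame (∂_s, ∂_θ) = (e^{s+iθ}, i
e^{s+iθ}). -/
theorem exp_mul_polar (y : ℝ × ℝ) (c d : ℝ) :
    Complex.exp (y.1 + y.2 * Complex.I) *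
      (((Real.exp (-y.1) * (c * Real.cos y.2 + d * Real.sin y.2) : ℝ) : ℂ) +
      ((Real.exp (-y.1) * (d * Real.cos y.2 - c * Real.sin y.2) : ℝ) : ℂ) * Complex.I) =
      c + d * Complex.I := by
  have h1 : Complex.exp (y.1) * Complex.exp (-y.1) = 1 := by
    rw [← Complex.exp_add]; simp
  rw [Complex.exp_add, Complex.exp_mul_I]
  push_cast
  have h2 := Complex.cos_sq_add_sin_sq (y.2 : ℂ)
  linear_combination (Complex.cos y.2 ^ 2 + Complex.sin y.2 ^ 2) * (c + d * Complex.I) * h1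
    + (c + d * Complex.I) * h2 + Complex.exp (y.1) * Complex.exp (-y.1) * (
       (Complex.sin y.2 * d * Complex.cos y.2 - Complex.sin y.2 ^ 2 * c)) * Complex.I_sq

theorem fderiv_prod_eq (Φ : ℝ × ℝ → ℝ) (y : ℝ × ℝ) (b c : ℝ) :
    fderiv ℝ Φ y (b, c) = b * fderiv ℝ Φ y (1, 0) + c * fderiv ℝ Φ y (0, 1) := by
  rw [← smul_eq_mul, ← smul_eq_mul, ← map_smul, ← map_smul, ← map_add]; simp

/-- Directional derivatives in logarithmic polar coordinates. -/
theorem fderiv_logPush_dir (h : IsTestOn logStrip Φ) {y : ℝ × ℝ} (hy : y ∈ logStrip) (c d : ℝ) :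
    fderiv ℝ (logPush Ψ Φ) (logChart Ψ y) (Ψ.symm (c + d * Complex.I)) =
      Real.exp (-y.1) * ((c * Real.cos y.2 + d * Real.sin y.2) * fderiv ℝ Φ y (1, 0) +
        (d * Real.cos y.2 - c * Real.sin y.2) * fderiv ℝ Φ y (0, 1)) := by
  have h2 := fderiv_logPush Ψ h hy (Real.exp (-y.1) * (c * Real.cos y.2 + d * Real.sin y.2),
    Real.exp (-y.1) * (d * Real.cos y.2 - c * Real.sin y.2))
  rw [exp_mul_polar y c d, fderiv_prod_eq] at h2
  rw [h2]; ring

end PushForward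

/-! ### Weak formulations in Euclidean space -/

section WeakForms

variable {n : ℕ}

theorem LocallyL2.locallyIntegrable {F : Type*} [NormedAddCommGroup F]
    {f : EuclideanSpace ℝ (Fin n) → F} (hf : LocallyL2 f) : LocallyIntegrable f := by
  refine locallyIntegrable_iff.2 fun K hK => ?_
  have : IsFiniteMeasure ((volume : Measure (EuclideanSpace ℝ (Fin n))).restrict K) :=
    ⟨by simpa using hK.measure_lt_top⟩
  exact (hf K hK).integrable one_le_two

theorem IsTestFun.fderiv_dir {φ : EuclideanSpace ℝ (Fin n) → ℝ} (h : IsTestFun φ)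
    (v : EuclideanSpace ℝ (Fin n)) : IsTestFun (fun x => fderiv ℝ φ x v) :=
  ⟨(h.smooth.fderiv_right (m := ∞) (by simp)).clm_apply contDiff_const,
    h.compact_support.fderiv_apply ℝ v⟩

theorem LocallyIntegrable.integrable_mul_testFun {f φ : EuclideanSpace ℝ (Fin n) → ℝ}
    (hf : LocallyIntegrable f) (h : IsTestFun φ) : Integrable (fun x => f x * φ x) :=
  hf.integrable_smul_right_of_hasCompactSupport h.smooth.continuous h.compact_support

theorem LocallyIntegrable.inner_const {G : EuclideanSpace ℝ (Fin n) → EuclideanSpace ℝ (Fin n)}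
    (hf : LocallyIntegrable G) (v : EuclideanSpace ℝ (Fin n)) :
    LocallyIntegrable (fun x => inner ℝ (G x) v) := by
  rw [locallyIntegrable_iff] at hf ⊢
  intro K hK
  exact (hf K hK).inner_const v

/-- `⟨Δq, φ⟩ = -∫ ∇q · ∇φ` for `q ∈ W^{1,2}_loc`. -/
theorem IsLocalSobolev.distLaplacian_eq {q φ : EuclideanSpace ℝ (Fin n) → ℝ}
    {G : EuclideanSpace ℝ (Fin n) → EuclideanSpace ℝ (Fin n)} (h : IsLocalSobolev q G)
    (hφ : IsTestFun φ) : distLaplacian q φ = -∫ x, fderiv ℝ φ x (G x) := by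
  set b := EuclideanSpace.basisFun (Fin n) ℝ
  have h1 : ∀ x, Laplacian.laplacian φ x =
      ∑ i, fderiv ℝ (fun y => fderiv ℝ φ y (b i)) x (b i) := by
    intro x
    rw [InnerProductSpace.laplacian_eq_iteratedFDeriv_orthonormalBasis φ b]
    refine Finset.sum_congr rfl fun i _ => ?_
    rw [iteratedFDeriv_two_apply]
    have hd : DifferentiableAt ℝ (fderiv ℝ φ) x :=
      ((hφ.smooth.fderiv_right (m := ∞) (by simp)).differentiable (by simp)).differentiableAt
    rw [fderiv_clm_apply hd (differentiableAt_const _)]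
    simp
  have h2 : ∀ x, fderiv ℝ φ x (G x) = ∑ i, fderiv ℝ φ x (b i) * inner ℝ (G x) (b i) := by
    intro x
    conv_lhs => rw [← b.sum_repr' (G x), map_sum]
    refine Finset.sum_congr rfl fun i _ => ?_
    rw [map_smul, smul_eq_mul, mul_comm, real_inner_comm]
  unfold distLaplacian
  simp only [h1, h2, Finset.mul_sum]
  rw [integral_finsetSum, integral_finsetSum, ← Finset.sum_neg_distrib]
  · exact Finset.sum_congr rfl fun i _ => h.weak_grad _ (hφ.fderiv_dir _) _
  · intro i _
    simp only [mul_comm (fderiv ℝ φ _ (b i))]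
    exact LocallyIntegrable.integrable_mul_testFun
      (LocallyIntegrable.inner_const h.grad_memL2.locallyIntegrable _) (hφ.fderiv_dir _)
  · intro i _
    exact LocallyIntegrable.integrable_mul_testFun h.memL2.locallyIntegrable
      ((hφ.fderiv_dir _).fderiv_dir _)

end WeakForms

/-! ### Partial derivatives and operations on test functions -/

section Partial

theorem fderiv_fst_eq {Φ : ℝ × ℝ → ℝ} {y : ℝ × ℝ} {d : ℝ} (h : DifferentiableAt ℝ Φ y)
    (hd : HasDerivAt (fun t => Φ (t, y.2)) d y.1) : fderiv ℝ Φ y (1, 0) = d := by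
  have h1 : HasDerivAt (fun t : ℝ => (t, y.2)) ((1 : ℝ), (0 : ℝ)) y.1 :=
    (hasDerivAt_id _).prodMk (hasDerivAt_const _ _)
  exact (HasFDerivAt.comp_hasDerivAt y.1 (f := fun t : ℝ => (t, y.2)) h.hasFDerivAt h1).unique hd

theorem fderiv_snd_eq {Φ : ℝ × ℝ → ℝ} {y : ℝ × ℝ} {d : ℝ} (h : DifferentiableAt ℝ Φ y)
    (hd : HasDerivAt (fun t => Φ (y.1, t)) d y.2) : fderiv ℝ Φ y (0, 1) = d := by
  have h1 : HasDerivAt (fun t : ℝ => (y.1, t)) ((0 : ℝ), (1 : ℝ)) y.2 :=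
    (hasDerivAt_const _ _).prodMk (hasDerivAt_id _)
  exact (HasFDerivAt.comp_hasDerivAt y.2 (f := fun t : ℝ => (y.1, t)) h.hasFDerivAt h1).unique hd

theorem hasDerivAt_fst {Φ : ℝ × ℝ → ℝ} {y : ℝ × ℝ} (h : DifferentiableAt ℝ Φ y) :
    HasDerivAt (fun t => Φ (t, y.2)) (fderiv ℝ Φ y (1, 0)) y.1 := by
  have h1 : HasDerivAt (fun t : ℝ => (t, y.2)) ((1 : ℝ), (0 : ℝ)) y.1 :=
    (hasDerivAt_id _).prodMk (hasDerivAt_const _ _)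
  exact HasFDerivAt.comp_hasDerivAt y.1 (f := fun t : ℝ => (t, y.2)) h.hasFDerivAt h1

theorem hasDerivAt_snd {Φ : ℝ × ℝ → ℝ} {y : ℝ × ℝ} (h : DifferentiableAt ℝ Φ y) :
    HasDerivAt (fun t => Φ (y.1, t)) (fderiv ℝ Φ y (0, 1)) y.2 := by
  have h1 : HasDerivAt (fun t : ℝ => (y.1, t)) ((0 : ℝ), (1 : ℝ)) y.2 :=
    (hasDerivAt_const _ _).prodMk (hasDerivAt_id _)
  exact HasFDerivAt.comp_hasDerivAt y.2 (f := fun t : ℝ => (y.1, t)) h.hasFDerivAt h1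

theorem IsTestOn.mul_left {E : Type*} [NormedAddCommGroup E] [NormedSpace ℝ E] {U : Set E}
    {Φ m : E → ℝ} (h : IsTestOn U Φ) (hm : ContDiff ℝ ∞ m) : IsTestOn U (fun y => m y * Φ y) :=
  ⟨hm.mul h.smooth, h.compact_support.mul_left,
    (closure_mono (Function.support_mul_subset_right _ _)).trans h.tsupport_subset⟩

theorem IsTestOn.mono {E : Type*} [NormedAddCommGroup E] [NormedSpace ℝ E] {U V : Set E}
    {Φ : E → ℝ} (h : IsTestOn U Φ) (hUV : U ⊆ V) : IsTestOn V Φ :=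
  ⟨h.smooth, h.compact_support, h.tsupport_subset.trans hUV⟩

theorem IsTestOn.differentiableAt {E : Type*} [NormedAddCommGroup E] [NormedSpace ℝ E] {U : Set E}
    {Φ : E → ℝ} (h : IsTestOn U Φ) (y : E) : DifferentiableAt ℝ Φ y :=
  (h.smooth.differentiable (by simp)).differentiableAt

theorem IsTestOn.fderiv_dir {E : Type*} [NormedAddCommGroup E] [NormedSpace ℝ E] {U : Set E}
    {Φ : E → ℝ} (h : IsTestOn U Φ) (v : E) : IsTestOn U (fun x => fderiv ℝ Φ x v) :=
  ⟨(h.smooth.fderiv_right (m := ∞) (by simp)).clm_apply contDiff_const,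
    h.compact_support.fderiv_apply ℝ v,
    (tsupport_fderiv_apply_subset ℝ v).trans h.tsupport_subset⟩

end Partial

/-! ### The problem in logarithmic polar coordinates -/

/-- The problem in logarithmic polar coordinates: `Q` is the solution, `P`, `T` are its weak
partial derivatives in the radial variable `s` and in the angle `θ`. -/
structure IsStripSolution (a : ℝ) (Q P T : ℝ × ℝ → ℝ) : Prop where
  locallyIntegrableOn : LocallyIntegrableOn Q logStrip
  locallyIntegrableOn_fst : LocallyIntegrableOn P logStrip
  locallyIntegrableOn_snd : LocallyIntegrableOn T logStrip
  weak_fst : ∀ Φ, IsTestOn logStrip Φ →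
    ∫ y in logStrip, Q y * fderiv ℝ Φ y (1, 0) = -∫ y in logStrip, P y * Φ y
  weak_snd : ∀ Φ, IsTestOn logStrip Φ →
    ∫ y in logStrip, Q y * fderiv ℝ Φ y (0, 1) = -∫ y in logStrip, T y * Φ y
  harmonic : ∀ Φ, IsTestOn (univ ×ˢ Ioo 0 Real.pi) Φ →
    ∫ y in logStrip, (P y * fderiv ℝ Φ y (1, 0) + T y * fderiv ℝ Φ y (0, 1)) = 0
  complementarity : ∀ Φ, IsTestOn logStrip Φ →
    ∫ y in logStrip, (Φ y * (P y ^ 2 + T y ^ 2) +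
      Q y * (P y * fderiv ℝ Φ y (1, 0) + T y * fderiv ℝ Φ y (0, 1))) = 0
  even : ∀ᵐ y ∂volume.restrict logStrip, Q (y.1, -y.2) = Q y
  homogeneous : ∀ τ, ∀ᵐ y ∂volume.restrict logStrip, Q (y.1 + τ, y.2) = Real.exp (a * τ) * Q y
  energy : IntegrableOn (fun y => P y ^ 2 + T y ^ 2) (Iic 0 ×ˢ Ioo 0 Real.pi)

section LogForms

variable (Ψ : 𝔼 ≃ₗᵢ[ℝ] ℂ)

theorem locallyIntegrableOn_logChart {f : 𝔼 → ℝ} (hf : LocallyIntegrable f) :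
    LocallyIntegrableOn (fun y => f (logChart Ψ y)) logStrip := by
  refine (locallyIntegrableOn_iff isOpen_logStrip.isLocallyClosed).2 fun K hKs hK => ?_
  have h1 : IntegrableOn f (logChart Ψ '' K) :=
    locallyIntegrable_iff.1 hf _ (hK.image (continuous_logChart Ψ))
  rw [integrableOn_image_logChart Ψ hK.measurableSet hKs] at h1
  have h2 := IntegrableOn.continuousOn_mul (g := fun y : ℝ × ℝ => Real.exp (-(2 * y.1)))
    (by fun_prop) h1 hK
  refine h2.congr_fun (fun y _ => ?_) hK.measurableSet
  simp only [smul_eq_mul, ← mul_assoc, ← Real.exp_add]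
  simp

theorem integral_logChart_mul (f : 𝔼 → ℝ) :
    ∫ x, f x = ∫ y in logStrip, Real.exp (2 * y.1) * f (logChart Ψ y) :=
  integral_logChart Ψ f

theorem inner_symm_eq (x : 𝔼) (w : ℂ) :
    inner ℝ x (Ψ.symm w) = (Ψ x).re * w.re + (Ψ x).im * w.im := by
  rw [← Ψ.inner_map_map x, LinearIsometryEquiv.apply_symm_apply, Complex.inner]
  simp; ring

theorem norm_sq_eq_re_im (x : 𝔼) : ‖x‖ ^ 2 = (Ψ x).re ^ 2 + (Ψ x).im ^ 2 := by
  rw [← Ψ.norm_map, ← Complex.normSq_eq_norm_sq, Complex.normSq_apply]; ring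

/-- The radial logarithmic derivative of a function with gradient `G`. -/
noncomputable def logRadial (G : 𝔼 → 𝔼) (y : ℝ × ℝ) : ℝ :=
  Real.exp y.1 * (Real.cos y.2 * (Ψ (G (logChart Ψ y))).re +
    Real.sin y.2 * (Ψ (G (logChart Ψ y))).im)

/-- The angular derivative of a function with gradient `G`. -/
noncomputable def logAngular (G : 𝔼 → 𝔼) (y : ℝ × ℝ) : ℝ :=
  Real.exp y.1 * (Real.cos y.2 * (Ψ (G (logChart Ψ y))).im -
    Real.sin y.2 * (Ψ (G (logChart Ψ y))).re)

theorem logRadial_sq_add_logAngular_sq (G : 𝔼 → 𝔼) (y : ℝ × ℝ) :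
    logRadial Ψ G y ^ 2 + logAngular Ψ G y ^ 2 =
      Real.exp (2 * y.1) * ‖G (logChart Ψ y)‖ ^ 2 := by
  rw [norm_sq_eq_re_im Ψ, logRadial, logAngular, two_mul, Real.exp_add]
  linear_combination Real.exp y.1 * Real.exp y.1 * ((Ψ (G (logChart Ψ y))).re ^ 2 +
    (Ψ (G (logChart Ψ y))).im ^ 2) * Real.cos_sq_add_sin_sq y.2

theorem exp_two_mul_mul_fderiv_logPush {Φ : ℝ × ℝ → ℝ} (h : IsTestOn logStrip Φ) (G : 𝔼 → 𝔼)
    {y : ℝ × ℝ} (hy : y ∈ logStrip) :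
    Real.exp (2 * y.1) * fderiv ℝ (logPush Ψ Φ) (logChart Ψ y) (G (logChart Ψ y)) =
      logRadial Ψ G y * fderiv ℝ Φ y (1, 0) + logAngular Ψ G y * fderiv ℝ Φ y (0, 1) := by
  have h1 := fderiv_logPush_dir Ψ h hy (Ψ (G (logChart Ψ y))).re (Ψ (G (logChart Ψ y))).im
  rw [Complex.re_add_im, LinearIsometryEquiv.symm_apply_apply] at h1
  rw [h1, logRadial, logAngular, ← mul_assoc, ← Real.exp_add]
  ring_nf

theorem locallyIntegrable_re {G : 𝔼 → 𝔼} (hG : LocallyIntegrable G) :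
    LocallyIntegrable (fun x => (Ψ (G x)).re) := by
  have := LocallyIntegrable.inner_const hG (Ψ.symm 1)
  simpa [inner_symm_eq] using this

theorem locallyIntegrable_im {G : 𝔼 → 𝔼} (hG : LocallyIntegrable G) :
    LocallyIntegrable (fun x => (Ψ (G x)).im) := by
  have := LocallyIntegrable.inner_const hG (Ψ.symm Complex.I)
  simpa [inner_symm_eq] using this

/-- The weak gradient tested against the vector field with Cartesian components `Φ₁`, `Φ₂`. Both are
kept at once because the radial and angular fields mix them. -/
theorem weak_grad_logChart {q : 𝔼 → ℝ} {G : 𝔼 → 𝔼} (h : IsLocalSobolev q G)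
    {Φ₁ Φ₂ : ℝ × ℝ → ℝ} (h₁ : IsTestOn logStrip Φ₁) (h₂ : IsTestOn logStrip Φ₂) :
    ∫ y in logStrip, q (logChart Ψ y) * (Real.exp y.1 *
      (Real.cos y.2 * fderiv ℝ Φ₁ y (1, 0) - Real.sin y.2 * fderiv ℝ Φ₁ y (0, 1) +
       (Real.sin y.2 * fderiv ℝ Φ₂ y (1, 0) + Real.cos y.2 * fderiv ℝ Φ₂ y (0, 1)))) =
    -∫ y in logStrip, Real.exp (2 * y.1) * ((Ψ (G (logChart Ψ y))).re * Φ₁ y +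
      (Ψ (G (logChart Ψ y))).im * Φ₂ y) := by
  have t₁ := isTestFun_logPush Ψ h₁
  have t₂ := isTestFun_logPush Ψ h₂
  have w₁ := h.weak_grad _ t₁ (Ψ.symm 1)
  have w₂ := h.weak_grad _ t₂ (Ψ.symm Complex.I)
  have e := congrArg₂ (· + ·) w₁ w₂
  have hq := h.memL2.locallyIntegrable
  have hG := h.grad_memL2.locallyIntegrable
  simp only [inner_symm_eq, Complex.one_re, Complex.one_im, Complex.I_re, Complex.I_im, mul_one,
    mul_zero, add_zero, zero_add] at e
  have i₁ : Integrable fun x => logPush Ψ Φ₁ x * (Ψ (G x)).re := by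
    simpa only [mul_comm] using LocallyIntegrable.integrable_mul_testFun
      (locallyIntegrable_re Ψ hG) t₁
  have i₂ : Integrable fun x => logPush Ψ Φ₂ x * (Ψ (G x)).im := by
    simpa only [mul_comm] using LocallyIntegrable.integrable_mul_testFun
      (locallyIntegrable_im Ψ hG) t₂
  rw [← neg_add, ← integral_add i₁ i₂,
    ← integral_add (LocallyIntegrable.integrable_mul_testFun hq (t₁.fderiv_dir _))
      (LocallyIntegrable.integrable_mul_testFun hq (t₂.fderiv_dir _)),
    integral_logChart_mul Ψ, integral_logChart_mul Ψ] at e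
  convert! e using 1
  · refine setIntegral_congr_fun isOpen_logStrip.measurableSet fun y hy => ?_
    have d₁ := fderiv_logPush_dir Ψ h₁ hy 1 0
    have d₂ := fderiv_logPush_dir Ψ h₂ hy 0 1
    simp only [Complex.ofReal_one, Complex.ofReal_zero, zero_mul, one_mul, add_zero, zero_add,
      sub_zero, zero_sub] at d₁ d₂
    simp only [d₁, d₂]
    have : Real.exp (2 * y.1) * Real.exp (-y.1) = Real.exp y.1 := by
      rw [← Real.exp_add]; ring_nf
    rw [← this]; ring
  · congr 1
    refine setIntegral_congr_fun isOpen_logStrip.measurableSet fun y hy => ?_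
    simp only [logPush_logChart Ψ _ hy]
    ring

theorem fderiv_fst_mul_mul {f k : ℝ → ℝ} {Φ : ℝ × ℝ → ℝ} {y : ℝ × ℝ} {f' : ℝ}
    (hΦ : DifferentiableAt ℝ Φ y) (hf : HasDerivAt f f' y.1) (hk : DifferentiableAt ℝ k y.2) :
    fderiv ℝ (fun y => f y.1 * k y.2 * Φ y) y (1, 0) =
      f' * k y.2 * Φ y + f y.1 * k y.2 * fderiv ℝ Φ y (1, 0) := by
  have e : HasDerivAt (fun t => f t * k y.2 * Φ (t, y.2))
      (f' * k y.2 * Φ y + f y.1 * k y.2 * fderiv ℝ Φ y (1, 0)) y.1 :=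
    (hf.mul_const _).mul (hasDerivAt_fst hΦ)
  refine fderiv_fst_eq ?_ e
  exact ((hf.differentiableAt.comp y differentiableAt_fst).mul
    (hk.comp y differentiableAt_snd)).mul hΦ

theorem fderiv_snd_mul_mul {f k : ℝ → ℝ} {Φ : ℝ × ℝ → ℝ} {y : ℝ × ℝ} {k' : ℝ}
    (hΦ : DifferentiableAt ℝ Φ y) (hf : DifferentiableAt ℝ f y.1) (hk : HasDerivAt k k' y.2) :
    fderiv ℝ (fun y => f y.1 * k y.2 * Φ y) y (0, 1) =
      f y.1 * k' * Φ y + f y.1 * k y.2 * fderiv ℝ Φ y (0, 1) := by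
  have e : HasDerivAt (fun t => f y.1 * k t * Φ (y.1, t))
      (f y.1 * k' * Φ y + f y.1 * k y.2 * fderiv ℝ Φ y (0, 1)) y.2 :=
    (hk.const_mul _).mul (hasDerivAt_snd hΦ)
  refine fderiv_snd_eq ?_ e
  exact ((hf.comp y differentiableAt_fst).mul
    (hk.differentiableAt.comp y differentiableAt_snd)).mul hΦ

/-- The test field is `Φ` times e^{-s}(cos θ, sin θ) = x/|x|². This field is divergence free off the
origin, so no zeroth-order term in `Φ` survives. -/
theorem weak_fst_logChart {q : 𝔼 → ℝ} {G : 𝔼 → 𝔼} (h : IsLocalSobolev q G)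
    {Φ : ℝ × ℝ → ℝ} (hΦ : IsTestOn logStrip Φ) :
    ∫ y in logStrip, q (logChart Ψ y) * fderiv ℝ Φ y (1, 0) =
      -∫ y in logStrip, logRadial Ψ G y * Φ y := by
  have hexp : ∀ s : ℝ, HasDerivAt (fun s => Real.exp (-s)) (-Real.exp (-s)) s := fun s => by
    simpa using (hasDerivAt_neg s).exp
  have h₁ : IsTestOn logStrip (fun y : ℝ × ℝ => Real.exp (-y.1) * Real.cos y.2 * Φ y) :=
    hΦ.mul_left (by fun_prop)
  have h₂ : IsTestOn logStrip (fun y : ℝ × ℝ => Real.exp (-y.1) * Real.sin y.2 * Φ y) :=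
    hΦ.mul_left (by fun_prop)
  have e := weak_grad_logChart Ψ h h₁ h₂
  convert! e using 1
  · congr 1 with y
    have hd := hΦ.differentiableAt y
    rw [fderiv_fst_mul_mul (f := fun s => Real.exp (-s)) hd (hexp _)
        Real.differentiableAt_cos, fderiv_fst_mul_mul (f := fun s => Real.exp (-s)) hd (hexp _)
        Real.differentiableAt_sin, fderiv_snd_mul_mul (f := fun s => Real.exp (-s)) hd
        (hexp _).differentiableAt (Real.hasDerivAt_cos _), fderiv_snd_mul_mul
        (f := fun s => Real.exp (-s)) hd (hexp _).differentiableAt (Real.hasDerivAt_sin _)]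
    have h1 : Real.exp y.1 * Real.exp (-y.1) = 1 := by rw [← Real.exp_add]; simp
    have h2 := Real.cos_sq_add_sin_sq y.2
    linear_combination (-(q (logChart Ψ y)) * fderiv ℝ Φ y (1, 0)) * h1 -
      (q (logChart Ψ y)) * fderiv ℝ Φ y (1, 0) * Real.exp y.1 * Real.exp (-y.1) * h2
  · congr 1
    congr 1 with y
    have h1 : Real.exp (2 * y.1) * Real.exp (-y.1) = Real.exp y.1 := by
      rw [← Real.exp_add]; ring_nf
    rw [logRadial, ← h1]
    ring

/-- As for the radial derivative, with the divergence-free rotational field e^{-s}(-sin θ, cos θ).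
-/
theorem weak_snd_logChart {q : 𝔼 → ℝ} {G : 𝔼 → 𝔼} (h : IsLocalSobolev q G)
    {Φ : ℝ × ℝ → ℝ} (hΦ : IsTestOn logStrip Φ) :
    ∫ y in logStrip, q (logChart Ψ y) * fderiv ℝ Φ y (0, 1) =
      -∫ y in logStrip, logAngular Ψ G y * Φ y := by
  have hexp : ∀ s : ℝ, HasDerivAt (fun s => Real.exp (-s)) (-Real.exp (-s)) s := fun s => by
    simpa using (hasDerivAt_neg s).exp
  have h₁ : IsTestOn logStrip (fun y : ℝ × ℝ => Real.exp (-y.1) * (-Real.sin y.2) * Φ y) :=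
    hΦ.mul_left (by fun_prop)
  have h₂ : IsTestOn logStrip (fun y : ℝ × ℝ => Real.exp (-y.1) * Real.cos y.2 * Φ y) :=
    hΦ.mul_left (by fun_prop)
  have e := weak_grad_logChart Ψ h h₁ h₂
  convert! e using 1
  · congr 1 with y
    have hd := hΦ.differentiableAt y
    rw [fderiv_fst_mul_mul (f := fun s => Real.exp (-s)) (k := fun t => -Real.sin t) hd (hexp _)
        Real.differentiableAt_sin.neg, fderiv_fst_mul_mul (f := fun s => Real.exp (-s)) hd (hexp _)
        Real.differentiableAt_cos, fderiv_snd_mul_mul (f := fun s => Real.exp (-s))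
        (k := fun t => -Real.sin t) hd
        (hexp _).differentiableAt (Real.hasDerivAt_sin _).neg, fderiv_snd_mul_mul
        (f := fun s => Real.exp (-s)) hd (hexp _).differentiableAt (Real.hasDerivAt_cos _)]
    have h1 : Real.exp y.1 * Real.exp (-y.1) = 1 := by rw [← Real.exp_add]; simp
    have h2 := Real.cos_sq_add_sin_sq y.2
    linear_combination (-(q (logChart Ψ y)) * fderiv ℝ Φ y (0, 1)) * h1 -
      (q (logChart Ψ y)) * fderiv ℝ Φ y (0, 1) * Real.exp y.1 * Real.exp (-y.1) * h2
  · congr 1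
    congr 1 with y
    have h1 : Real.exp (2 * y.1) * Real.exp (-y.1) = Real.exp y.1 := by
      rw [← Real.exp_add]; ring_nf
    rw [logAngular, ← h1]
    ring

theorem apply_logChart (y : ℝ × ℝ) : Ψ (logChart Ψ y) = Complex.exp (y.1 + y.2 * Complex.I) := by
  simp [logChart]

theorem norm_logChart (y : ℝ × ℝ) : ‖logChart Ψ y‖ = Real.exp y.1 := by
  rw [← Ψ.norm_map, apply_logChart, Complex.norm_exp]; simp

theorem smul_logChart (τ : ℝ) (y : ℝ × ℝ) :
    Real.exp τ • logChart Ψ y = logChart Ψ (y.1 + τ, y.2) := by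
  unfold logChart
  rw [← map_smul, Complex.real_smul, Complex.ofReal_exp, ← Complex.exp_add]
  congr 2; push_cast; ring

/-- Once `L` is the real axis, the reflection is complex conjugation, which changes the sign of θ.
-/
theorem reflection_logChart {L : Submodule ℝ 𝔼} (hΨ : ∀ x, x ∈ L ↔ (Ψ x).im = 0) (y : ℝ × ℝ) :
    L.reflection (logChart Ψ y) = logChart Ψ (y.1, -y.2) := by
  have key : ∀ w : ℂ, L.reflection (Ψ.symm w) = Ψ.symm (starRingEnd ℂ w) := by
    intro w
    have h1 : Ψ.symm (w.re : ℂ) ∈ L := by simp [hΨ]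
    have h2 : Ψ.symm (w.im * Complex.I) ∈ Lᗮ := by
      rw [Submodule.mem_orthogonal]
      intro u hu
      rw [inner_symm_eq]
      simp [(hΨ u).1 hu]
    conv_lhs => rw [← Complex.re_add_im w, map_add, map_add]
    rw [Submodule.reflection_mem_subspace_eq_self h1,
      Submodule.reflection_mem_subspace_orthogonalComplement_eq_neg h2, ← map_neg, ← map_add]
    congr 1
    apply Complex.ext <;> simp
  rw [logChart, key, logChart, ← Complex.exp_conj]
  simp

/-- The passage to logarithmic polar coordinates. -/
theorem isStripSolution_logChart {L : Submodule ℝ 𝔼} (hΨ : ∀ x, x ∈ L ↔ (Ψ x).im = 0)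
    {q : 𝔼 → ℝ} {G : 𝔼 → 𝔼} (h : IsLocalSobolev q G)
    (hc : ∀ φ, IsTestFun φ → distMulLaplacian q G φ = 0)
    (hΔ : ∀ φ, IsTestFun φ → tsupport φ ⊆ (L : Set 𝔼)ᶜ → distLaplacian q φ = 0)
    (heven : IsEvenSymmetric L q) {a : ℝ} (hhom : IsHomogeneousOfDegree a q) :
    IsStripSolution a (fun y => q (logChart Ψ y)) (logRadial Ψ G) (logAngular Ψ G) where
  locallyIntegrableOn := locallyIntegrableOn_logChart Ψ h.memL2.locallyIntegrable
  locallyIntegrableOn_fst := by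
    have hG := h.grad_memL2.locallyIntegrable
    have hl := isOpen_logStrip.isLocallyClosed
    exact ((((locallyIntegrableOn_logChart Ψ (locallyIntegrable_re Ψ hG)).continuousOn_mul
      (g := fun y => Real.cos y.2) (by fun_prop) hl).add
      ((locallyIntegrableOn_logChart Ψ (locallyIntegrable_im Ψ hG)).continuousOn_mul
      (g := fun y => Real.sin y.2) (by fun_prop) hl))).continuousOn_mul
      (g := fun y => Real.exp y.1) (by fun_prop) hl
  locallyIntegrableOn_snd := by
    have hG := h.grad_memL2.locallyIntegrable
    have hl := isOpen_logStrip.isLocallyClosed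
    exact ((((locallyIntegrableOn_logChart Ψ (locallyIntegrable_im Ψ hG)).continuousOn_mul
      (g := fun y => Real.cos y.2) (by fun_prop) hl).sub
      ((locallyIntegrableOn_logChart Ψ (locallyIntegrable_re Ψ hG)).continuousOn_mul
      (g := fun y => Real.sin y.2) (by fun_prop) hl))).continuousOn_mul
      (g := fun y => Real.exp y.1) (by fun_prop) hl
  weak_fst Φ hΦ := weak_fst_logChart Ψ h hΦ
  weak_snd Φ hΦ := weak_snd_logChart Ψ h hΦ
  harmonic Φ hΦ := by
    have hsub : (univ ×ˢ Ioo 0 Real.pi : Set (ℝ × ℝ)) ⊆ logStrip := by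
      intro y hy
      have := hy.2
      exact mem_logStrip.2 ⟨by linarith [this.1, Real.pi_pos], this.2⟩
    have hΦ' := hΦ.mono hsub
    have h1 : tsupport (logPush Ψ Φ) ⊆ (L : Set 𝔼)ᶜ := by
      intro x hx hxL
      obtain ⟨y, hy, rfl⟩ := tsupport_logPush_subset Ψ hΦ.compact_support hx
      have h2 := (hΨ _).1 hxL
      rw [apply_logChart, Complex.exp_im] at h2
      have h3 := (hΦ.tsupport_subset hy).2
      have h4 := Real.sin_pos_of_mem_Ioo h3
      simp [h4.ne'] at h2
    have h5 := hΔ _ (isTestFun_logPush Ψ hΦ') h1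
    rw [h.distLaplacian_eq (isTestFun_logPush Ψ hΦ'), integral_logChart_mul Ψ, neg_eq_zero] at h5
    refine Eq.trans ?_ h5
    exact setIntegral_congr_fun isOpen_logStrip.measurableSet fun y hy =>
      (exp_two_mul_mul_fderiv_logPush Ψ hΦ' G hy).symm
  complementarity Φ hΦ := by
    have h5 := hc _ (isTestFun_logPush Ψ hΦ)
    simp only [distMulLaplacian, inner_gradient_right, conj_trivial] at h5
    rw [integral_logChart_mul Ψ, neg_eq_zero] at h5
    refine Eq.trans ?_ h5
    refine setIntegral_congr_fun isOpen_logStrip.measurableSet fun y hy => ?_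
    simp only [logRadial_sq_add_logAngular_sq, ← exp_two_mul_mul_fderiv_logPush Ψ hΦ G hy,
      logPush_logChart Ψ _ hy, mul_add]
    ring
  even := by
    filter_upwards [(quasiMeasurePreserving_logChart Ψ).ae heven] with y hy
    rwa [reflection_logChart Ψ hΨ] at hy
  homogeneous τ := by
    filter_upwards [(quasiMeasurePreserving_logChart Ψ).ae (hhom _ (Real.exp_pos τ))] with y hy
    rw [smul_logChart] at hy
    rw [hy, ← Real.exp_mul, mul_comm a]
  energy := by
    have hm : MeasurableSet (Iic 0 ×ˢ Ioo 0 Real.pi : Set (ℝ × ℝ)) :=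
      measurableSet_Iic.prod measurableSet_Ioo
    have hsub : (Iic 0 ×ˢ Ioo 0 Real.pi : Set (ℝ × ℝ)) ⊆ logStrip := by
      intro y hy
      have := hy.2
      exact mem_logStrip.2 ⟨by linarith [this.1, Real.pi_pos], this.2⟩
    -- The Dirichlet integral is conformally invariant, and the half-strip s ≤ 0 is mapped into the
    -- unit ball, where |∇q|² is integrable.
    have h1 : IntegrableOn (fun x => ‖G x‖ ^ 2) (Metric.closedBall 0 1) :=
      (h.grad_memL2 _ (isCompact_closedBall 0 1)).integrable_norm_pow (p := 2) two_ne_zero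
    have h2 : logChart Ψ '' (Iic 0 ×ˢ Ioo 0 Real.pi) ⊆ Metric.closedBall 0 1 := by
      rintro _ ⟨y, hy, rfl⟩
      simpa [norm_logChart] using hy.1
    have h3 := (integrableOn_image_logChart Ψ hm hsub _).1 (h1.mono_set h2)
    exact h3.congr_fun (fun y _ => (logRadial_sq_add_logAngular_sq Ψ G y).symm) hm

end LogForms

/-! ### Weak solutions of g'' + a²g = 0 -/

section OscillatorEquation

/-- The solution of `s'' = -a² s`, `s(0) = 0`, `s'(0) = 1`. -/
noncomputable def oscSin (a θ : ℝ) : ℝ := if a = 0 then θ else Real.sin (a * θ) / a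

theorem oscSin_zero (a : ℝ) : oscSin a 0 = 0 := by
  unfold oscSin; split_ifs <;> simp

theorem hasDerivAt_oscSin (a θ : ℝ) : HasDerivAt (oscSin a) (Real.cos (a * θ)) θ := by
  unfold oscSin
  split_ifs with h
  · simpa [h] using hasDerivAt_id' θ
  · have := (((hasDerivAt_id θ).const_mul a).sin).div_const a
    convert! this using 1
    simp [h]

theorem mul_oscSin (a θ : ℝ) : a * oscSin a θ = Real.sin (a * θ) := by
  unfold oscSin
  split_ifs with h
  · simp [h]
  · field_simp

theorem hasDerivAt_cos_mul (a θ : ℝ) :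
    HasDerivAt (fun θ => Real.cos (a * θ)) (-(a ^ 2 * oscSin a θ)) θ := by
  have := ((hasDerivAt_id θ).const_mul a).cos
  convert! this using 1
  rw [pow_two, mul_assoc, mul_oscSin]
  simp [mul_comm]

theorem contDiff_oscSin (a : ℝ) : ContDiff ℝ ∞ (oscSin a) := by
  unfold oscSin
  split_ifs <;> fun_prop

theorem cos_sq_add_oscSin_sq (a θ : ℝ) :
    Real.cos (a * θ) ^ 2 + a ^ 2 * oscSin a θ ^ 2 = 1 := by
  rw [← mul_pow, mul_oscSin, Real.cos_sq_add_sin_sq]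

theorem IsTestOn.exists_Icc {α β : ℝ} (hαβ : α < β) {χ : ℝ → ℝ} (h : IsTestOn (Ioo α β) χ) :
    ∃ α' β', α < α' ∧ α' ≤ β' ∧ β' < β ∧ ∀ t, t ∉ Icc α' β' → χ t = 0 := by
  rcases (tsupport χ).eq_empty_or_nonempty with h0 | hne
  · refine ⟨(α + β) / 2, (α + β) / 2, by linarith, le_rfl, by linarith, fun t _ => ?_⟩
    exact image_eq_zero_of_notMem_tsupport (by simp [h0])
  · obtain ⟨α', h1, h1'⟩ := h.compact_support.isCompact.exists_isLeast hne
    obtain ⟨β', h2, h2'⟩ := h.compact_support.isCompact.exists_isGreatest hne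
    refine ⟨α', β', (h.tsupport_subset h1).1, h2' h1, (h.tsupport_subset h2).2, fun t ht => ?_⟩
    exact image_eq_zero_of_notMem_tsupport fun ht' => ht ⟨h1' ht', h2' ht'⟩

theorem IsTestOn.of_forall_Icc {α β α' β' : ℝ} {χ : ℝ → ℝ} (hs : ContDiff ℝ ∞ χ) (hα : α < α')
    (hβ : β' < β) (h0 : ∀ t, t ∉ Icc α' β' → χ t = 0) : IsTestOn (Ioo α β) χ := by
  have hsub : tsupport χ ⊆ Icc α' β' :=
    closure_minimal (fun t ht => by_contra fun h => ht (h0 t h)) isClosed_Icc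
  exact ⟨hs, isCompact_Icc.of_isClosed_subset (isClosed_tsupport _) hsub,
    hsub.trans fun t ht => ⟨hα.trans_le ht.1, ht.2.trans_lt hβ⟩⟩

/-- The primitive of a test function of mean zero is a test function. -/
theorem IsTestOn.primitive {α β : ℝ} (hαβ : α < β) {χ : ℝ → ℝ} (h : IsTestOn (Ioo α β) χ)
    (h0 : ∫ t, χ t = 0) : IsTestOn (Ioo α β) (fun t => ∫ x in α..t, χ x) ∧
      ∀ t, HasDerivAt (fun t => ∫ x in α..t, χ x) (χ t) t := by
  have hc := h.smooth.continuous
  have hd : ∀ t, HasDerivAt (fun t => ∫ x in α..t, χ x) (χ t) t := fun t =>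
    intervalIntegral.integral_hasDerivAt_right (hc.intervalIntegrable _ _)
      hc.stronglyMeasurable.stronglyMeasurableAtFilter hc.continuousAt
  refine ⟨?_, hd⟩
  have hs : ContDiff ℝ ∞ (fun t => ∫ x in α..t, χ x) := by
    rw [contDiff_infty_iff_deriv]
    refine ⟨fun t => (hd t).differentiableAt, ?_⟩
    rw [show deriv (fun t => ∫ x in α..t, χ x) = χ from funext fun t => (hd t).deriv]
    exact h.smooth
  obtain ⟨α', β', h1, h2, h3, h4⟩ := h.exists_Icc hαβ
  refine IsTestOn.of_forall_Icc hs h1 h3 fun t ht => ?_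
  rcases lt_or_ge t α' with h5 | h5
  · have : ∫ x in α..t, χ x = ∫ x in α..t, (0 : ℝ) := by
      refine intervalIntegral.integral_congr fun x hx => h4 x fun hx' => ?_
      have : x ≤ max α t := hx.2
      rcases le_max_iff.1 this with h | h <;> linarith [hx'.1]
    simpa using this
  · have h6 : β' < t := by
      by_contra h7
      exact ht ⟨h5, not_lt.1 h7⟩
    have h7 : ∫ x in α..t, χ x = ∫ x, χ x := by
      refine intervalIntegral.integral_eq_integral_of_support_subset fun x hx => ?_
      have : x ∈ Icc α' β' := by_contra fun h => hx (h4 x h)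
      exact ⟨h1.trans_le this.1, this.2.trans h6.le⟩
    exact h7.trans h0

theorem IsTestOn.add {E : Type*} [NormedAddCommGroup E] [NormedSpace ℝ E] {U : Set E}
    {Φ χ : E → ℝ} (h : IsTestOn U Φ) (h' : IsTestOn U χ) : IsTestOn U (fun y => Φ y + χ y) :=
  ⟨h.smooth.add h'.smooth, h.compact_support.add h'.compact_support,
    (tsupport_add Φ χ).trans (union_subset h.tsupport_subset h'.tsupport_subset)⟩

/-- Variation of constants. The primitives of cos(at)χ and `oscSin a t` χ have compact support
exactly because χ is orthogonal to both homogeneous solutions. -/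
theorem IsTestOn.exists_oscillator {a α β : ℝ} (hαβ : α < β) {χ : ℝ → ℝ}
    (h : IsTestOn (Ioo α β) χ) (hc : ∫ t, Real.cos (a * t) * χ t = 0)
    (hs : ∫ t, oscSin a t * χ t = 0) :
    ∃ ψ : ℝ → ℝ, IsTestOn (Ioo α β) ψ ∧ ∀ t, deriv (deriv ψ) t + a ^ 2 * ψ t = χ t := by
  obtain ⟨hU, hU'⟩ := (h.mul_left (m := fun t => Real.cos (a * t))
    (by fun_prop)).primitive hαβ hc
  obtain ⟨hV, hV'⟩ := (h.mul_left (contDiff_oscSin a)).primitive hαβ hs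
  set U := fun t => ∫ x in α..t, Real.cos (a * x) * χ x
  set V := fun t => ∫ x in α..t, oscSin a x * χ x
  refine ⟨fun t => oscSin a t * U t + -Real.cos (a * t) * V t,
    (hU.mul_left (contDiff_oscSin a)).add (hV.mul_left (m := fun t => -Real.cos (a * t))
      (by fun_prop)), fun t => ?_⟩
  have h1 : ∀ t, HasDerivAt (fun t => oscSin a t * U t + -Real.cos (a * t) * V t)
      (Real.cos (a * t) * U t + a ^ 2 * oscSin a t * V t) t := by
    intro t
    refine (((hasDerivAt_oscSin a t).mul (hU' t)).add
      ((hasDerivAt_cos_mul a t).neg.mul (hV' t))).congr_deriv ?_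
    simp only [Pi.neg_apply]
    ring
  have h2 : HasDerivAt (fun t => Real.cos (a * t) * U t + a ^ 2 * oscSin a t * V t)
      (χ t - a ^ 2 * (oscSin a t * U t + -Real.cos (a * t) * V t)) t := by
    refine (((hasDerivAt_cos_mul a t).mul (hU' t)).add
      (((hasDerivAt_oscSin a t).const_mul (a ^ 2)).mul (hV' t))).congr_deriv ?_
    linear_combination χ t * cos_sq_add_oscSin_sq a t
  rw [funext fun t => (h1 t).deriv, h2.deriv]
  ring

theorem IsTestOn.integrable_mul {E : Type*} [NormedAddCommGroup E] [NormedSpace ℝ E]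
    [MeasurableSpace E] [OpensMeasurableSpace E] [SecondCountableTopologyEither E ℝ]
    {μ : Measure E} {U : Set E} {f χ : E → ℝ} (h : IsTestOn U χ)
    (hf : LocallyIntegrableOn f U μ) : Integrable (fun x => f x * χ x) μ := by
  have h1 : IntegrableOn (fun x => χ x * f x) (tsupport χ) μ :=
    IntegrableOn.continuousOn_mul h.smooth.continuous.continuousOn
      (hf.integrableOn_compact_subset h.tsupport_subset h.compact_support.isCompact)
      h.compact_support.isCompact
  simp only [mul_comm (χ _)] at h1
  refine (integrableOn_iff_integrable_of_support_subset fun x hx => ?_).1 h1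
  exact subset_tsupport _ fun h0 => hx (by simp [h0])

/-- The test functions with support in an open set. -/
def testSubmodule (U : Set ℝ) : Submodule ℝ (ℝ → ℝ) where
  carrier := {χ | IsTestOn U χ}
  add_mem' h h' := h.add h'
  zero_mem' := ⟨contDiff_const, HasCompactSupport.zero, by simp [tsupport]⟩
  smul_mem' c _ h := h.mul_left (m := fun _ => c) contDiff_const

/-- Integration of test functions against a locally integrable function. -/
noncomputable def testPairing {U : Set ℝ} {f : ℝ → ℝ} (hf : LocallyIntegrableOn f U) :
    testSubmodule U →ₗ[ℝ] ℝ where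
  toFun χ := ∫ t, f t * (χ : ℝ → ℝ) t
  map_add' χ χ' := by
    rw [← integral_add (χ.2.integrable_mul hf) (χ'.2.integrable_mul hf)]
    simp [mul_add]
  map_smul' c χ := by
    rw [RingHom.id_apply, smul_eq_mul, ← integral_const_mul]
    congr 1 with t
    simp only [Submodule.coe_smul, Pi.smul_apply, smul_eq_mul]
    ring

/-- Distributional solutions of `g'' + a² g = 0` on an interval are classical solutions. -/
theorem ae_eq_of_weak_oscillator {a α β : ℝ} (hαβ : α < β) {g : ℝ → ℝ}
    (hg : LocallyIntegrableOn g (Ioo α β))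
    (h : ∀ ψ, IsTestOn (Ioo α β) ψ → ∫ t, g t * (deriv (deriv ψ) t + a ^ 2 * ψ t) = 0) :
    ∃ A B : ℝ, ∀ᵐ t, t ∈ Ioo α β → g t = A * Real.cos (a * t) + B * oscSin a t := by
  have hc : LocallyIntegrableOn (fun t => Real.cos (a * t)) (Ioo α β) :=
    (Continuous.locallyIntegrable (by fun_prop)).locallyIntegrableOn _
  have hs : LocallyIntegrableOn (oscSin a) (Ioo α β) :=
    ((contDiff_oscSin a).continuous.locallyIntegrable).locallyIntegrableOn _
  -- A linear functional vanishing on the common kernel of two others is a combination of them. On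
  -- that kernel χ = ψ'' + a²ψ for a test function ψ, and g annihilates such χ.
  have key : testPairing hg ∈ Submodule.span ℝ (range ![testPairing hc, testPairing hs]) := by
    refine mem_span_of_iInf_ker_le_ker fun χ hχ => ?_
    simp only [Submodule.mem_iInf, Fin.forall_fin_two, Matrix.cons_val_zero, Matrix.cons_val_one,
      LinearMap.mem_ker] at hχ
    obtain ⟨ψ, hψ, e⟩ := IsTestOn.exists_oscillator hαβ χ.2 hχ.1 hχ.2
    have := h ψ hψ
    simp only [e] at this
    exact this
  rw [Matrix.range_cons, Matrix.range_cons, Matrix.range_empty, union_empty,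
    singleton_union, Submodule.mem_span_pair] at key
  obtain ⟨A, B, hAB⟩ := key
  refine ⟨A, B, ?_⟩
  have hloc : LocallyIntegrableOn
      (fun t => g t - (A * Real.cos (a * t) + B * oscSin a t)) (Ioo α β) := by
    refine hg.sub (Continuous.locallyIntegrable ?_ |>.locallyIntegrableOn _)
    have := (contDiff_oscSin a).continuous
    fun_prop
  have := isOpen_Ioo.ae_eq_zero_of_integral_contDiff_smul_eq_zero hloc fun χ h1 h2 h3 => ?_
  · filter_upwards [this] with t ht ht'
    exact sub_eq_zero.1 (ht ht')
  · have hχ : IsTestOn (Ioo α β) χ := ⟨h1, h2, h3⟩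
    have e := LinearMap.congr_fun hAB ⟨χ, hχ⟩
    have e' : A * (∫ t, Real.cos (a * t) * χ t) + B * (∫ t, oscSin a t * χ t) =
      ∫ t, g t * χ t := e
    rw [← integral_const_mul, ← integral_const_mul, ← integral_add
      ((hχ.integrable_mul hc).const_mul _) ((hχ.integrable_mul hs).const_mul _)] at e'
    rw [← sub_eq_zero, ← integral_sub, ← neg_eq_zero, ← integral_neg] at e'
    · rw [← e']
      congr 1 with t
      simp only [smul_eq_mul]; ring
    · exact ((hχ.integrable_mul hc).const_mul _).add ((hχ.integrable_mul hs).const_mul _)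
    · exact hχ.integrable_mul hg

end OscillatorEquation

/-! ### Angular profiles -/

section Profile

/-- The angular profile `A cos(aθ) + B s(θ)`, the general solution of `h'' + a² h = 0`. -/
noncomputable def oscProfile (a A B θ : ℝ) : ℝ := A * Real.cos (a * θ) + B * oscSin a θ

/-- Differentiation preserves the solution space and acts on coefficients by (A, B) ↦ (B, -a²A). The
derivative k' is written as a profile in this way from here on. -/
theorem hasDerivAt_oscProfile (a A B θ : ℝ) :
    HasDerivAt (oscProfile a A B) (oscProfile a B (-(a ^ 2 * A)) θ) θ := by
  refine (((hasDerivAt_cos_mul a θ).const_mul A).add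
    ((hasDerivAt_oscSin a θ).const_mul B)).congr_deriv ?_
  unfold oscProfile; ring

theorem contDiff_oscProfile (a A B : ℝ) : ContDiff ℝ ∞ (oscProfile a A B) := by
  have := contDiff_oscSin a
  unfold oscProfile; fun_prop

theorem oscProfile_zero (a A B : ℝ) : oscProfile a A B 0 = A := by
  simp [oscProfile, oscSin_zero]

theorem oscProfile_neg (a A B θ : ℝ) : oscProfile a A B (-θ) = oscProfile a A (-B) θ := by
  have : oscSin a (-θ) = -oscSin a θ := by
    unfold oscSin; split_ifs <;> simp [neg_div]
  simp [oscProfile, this]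

/-- Conservation of energy for the oscillator. -/
theorem oscProfile_energy (a A B θ : ℝ) :
    a ^ 2 * oscProfile a A B θ ^ 2 + oscProfile a B (-(a ^ 2 * A)) θ ^ 2 =
      a ^ 2 * A ^ 2 + B ^ 2 := by
  unfold oscProfile
  linear_combination (a ^ 2 * A ^ 2 + B ^ 2) * cos_sq_add_oscSin_sq a θ

end Profile

/-! ### Weak derivatives of functions with a smooth representative -/

section WeakDerivative

variable {E : Type*} [NormedAddCommGroup E] [NormedSpace ℝ E] [FiniteDimensional ℝ E]
  [MeasurableSpace E] [BorelSpace E] {μ : Measure E} [μ.IsAddHaarMeasure]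

/-- The weak derivative of a function which is almost everywhere equal to a smooth function. -/
theorem ae_eq_fderiv_of_weak {S U : Set E} (hU : IsOpen U) (hS : MeasurableSet S) (hUS : U ⊆ S)
    {Q D R : E → ℝ} {v : E} (hD : LocallyIntegrableOn D S μ) (hR : ContDiff ℝ ∞ R)
    (hQR : ∀ᵐ y ∂μ.restrict U, Q y = R y)
    (hw : ∀ Φ, IsTestOn S Φ → ∫ y in S, Q y * fderiv ℝ Φ y v ∂μ = -∫ y in S, D y * Φ y ∂μ) :
    ∀ᵐ y ∂μ.restrict U, D y = fderiv ℝ R y v := by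
  have hR' : Continuous (fun y => fderiv ℝ R y v) :=
    ((hR.fderiv_right (m := ∞) (by simp)).clm_apply contDiff_const).continuous
  have hl : LocallyIntegrableOn (fun y => D y - fderiv ℝ R y v) U μ :=
    (hD.mono_set hUS).sub (hR'.locallyIntegrable.locallyIntegrableOn _)
  have := hU.ae_eq_zero_of_integral_contDiff_smul_eq_zero hl fun Φ h1 h2 h3 => ?_
  · rw [ae_restrict_iff' hU.measurableSet]
    filter_upwards [this] with y hy hyU
    exact sub_eq_zero.1 (hy hyU)
  have hΦ : IsTestOn U Φ := ⟨h1, h2, h3⟩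
  have e := hw Φ (hΦ.mono hUS)
  have iR : LocallyIntegrableOn R U μ := hR.continuous.locallyIntegrable.locallyIntegrableOn _
  have iR' : LocallyIntegrableOn (fun y => fderiv ℝ R y v) U μ :=
    hR'.locallyIntegrable.locallyIntegrableOn _
  have e1 : ∫ y in S, Q y * fderiv ℝ Φ y v ∂μ = ∫ y, R y * fderiv ℝ Φ y v ∂μ := by
    rw [← integral_indicator hS]
    refine integral_congr_ae ?_
    rw [ae_restrict_iff' hU.measurableSet] at hQR
    filter_upwards [hQR] with y hy
    by_cases hyU : y ∈ U
    · rw [indicator_of_mem (hUS hyU), hy hyU]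
    · have : fderiv ℝ Φ y v = 0 := image_eq_zero_of_notMem_tsupport
        (f := fun x => fderiv ℝ Φ x v) fun h => hyU ((hΦ.fderiv_dir v).tsupport_subset h)
      rw [this, mul_zero]
      by_cases hyS : y ∈ S
      · rw [indicator_of_mem hyS, this, mul_zero]
      · rw [indicator_of_notMem hyS]
  have e2 : ∫ y in S, D y * Φ y ∂μ = ∫ y, D y * Φ y ∂μ :=
    setIntegral_eq_integral_of_forall_compl_eq_zero fun y hy => by
      rw [image_eq_zero_of_notMem_tsupport fun h => hy (hUS (hΦ.tsupport_subset h)), mul_zero]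
  have e3 : ∫ y, R y * fderiv ℝ Φ y v ∂μ = -∫ y, fderiv ℝ R y v * Φ y ∂μ :=
    integral_mul_fderiv_eq_neg_fderiv_mul_of_integrable (hΦ.integrable_mul iR')
      ((hΦ.fderiv_dir v).integrable_mul iR) (hΦ.integrable_mul iR)
      (fun y _ => (hR.differentiable (by simp)).differentiableAt) fun y _ => hΦ.differentiableAt y
  rw [e1, e2, e3, neg_inj] at e
  simp only [smul_eq_mul, mul_sub]
  rw [integral_sub]
  · simp only [mul_comm (Φ _)]
    rw [e, sub_self]
  · simpa only [mul_comm] using hΦ.integrable_mul (hD.mono_set hUS)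
  · simpa only [mul_comm] using hΦ.integrable_mul iR'

end WeakDerivative

/-! ### Product test functions -/

section Tensor

theorem IsTestOn.tensor {U V : Set ℝ} {ρ ψ : ℝ → ℝ} (hρ : IsTestOn U ρ) (hψ : IsTestOn V ψ) :
    IsTestOn (U ×ˢ V) (fun y : ℝ × ℝ => ρ y.1 * ψ y.2) := by
  have hsub : Function.support (fun y : ℝ × ℝ => ρ y.1 * ψ y.2) ⊆ tsupport ρ ×ˢ tsupport ψ := by
    intro y hy
    exact ⟨subset_tsupport _ (left_ne_zero_of_mul hy), subset_tsupport _ (right_ne_zero_of_mul hy)⟩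
  have hK : IsCompact (tsupport ρ ×ˢ tsupport ψ) :=
    hρ.compact_support.isCompact.prod hψ.compact_support.isCompact
  exact ⟨(hρ.smooth.comp contDiff_fst).mul (hψ.smooth.comp contDiff_snd),
    HasCompactSupport.of_support_subset_isCompact hK hsub,
    (closure_minimal hsub hK.isClosed).trans (prod_mono hρ.tsupport_subset hψ.tsupport_subset)⟩

theorem fderiv_tensor_fst {ρ ψ : ℝ → ℝ} (hρ : Differentiable ℝ ρ) (hψ : Differentiable ℝ ψ)
    (y : ℝ × ℝ) :
    fderiv ℝ (fun y : ℝ × ℝ => ρ y.1 * ψ y.2) y (1, 0) = deriv ρ y.1 * ψ y.2 := by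
  have e : HasDerivAt (fun t => ρ t * ψ y.2) (deriv ρ y.1 * ψ y.2) y.1 :=
    (hρ y.1).hasDerivAt.mul_const _
  exact fderiv_fst_eq (by fun_prop) e

theorem fderiv_tensor_snd {ρ ψ : ℝ → ℝ} (hρ : Differentiable ℝ ρ) (hψ : Differentiable ℝ ψ)
    (y : ℝ × ℝ) :
    fderiv ℝ (fun y : ℝ × ℝ => ρ y.1 * ψ y.2) y (0, 1) = ρ y.1 * deriv ψ y.2 := by
  have e : HasDerivAt (fun t => ρ y.1 * ψ t) (ρ y.1 * deriv ψ y.2) y.2 :=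
    (hψ y.2).hasDerivAt.const_mul _
  exact fderiv_snd_eq (by fun_prop) e

theorem IsTestOn.deriv {U : Set ℝ} {ρ : ℝ → ℝ} (h : IsTestOn U ρ) : IsTestOn U (deriv ρ) := by
  simpa using h.fderiv_dir 1

theorem IsTestOn.differentiable {U : Set ℝ} {ρ : ℝ → ℝ} (h : IsTestOn U ρ) :
    Differentiable ℝ ρ := h.smooth.differentiable (by simp)

theorem IsTestOn.integrable_continuous_mul {U : Set ℝ} {f ρ : ℝ → ℝ} (h : IsTestOn U ρ)
    (hf : Continuous f) : Integrable (fun s => f s * ρ s) :=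
  h.integrable_mul (hf.locallyIntegrable.locallyIntegrableOn _)

theorem integral_exp_mul_deriv {ρ : ℝ → ℝ} (h : IsTestOn univ ρ) (c : ℝ) :
    ∫ s, Real.exp (c * s) * deriv ρ s = -(c * ∫ s, Real.exp (c * s) * ρ s) := by
  have hd : ∀ s, HasDerivAt (fun s => Real.exp (c * s)) (c * Real.exp (c * s)) s := by
    intro s
    refine (((hasDerivAt_id s).const_mul c).exp).congr_deriv ?_
    simp [mul_comm]
  rw [integral_mul_deriv_eq_deriv_mul_of_integrable (fun s _ => hd s)
    (fun s _ => (h.differentiable s).hasDerivAt) (h.deriv.integrable_continuous_mul (by fun_prop))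
    (h.integrable_continuous_mul (f := fun s => c * Real.exp (c * s)) (by fun_prop))
    (h.integrable_continuous_mul (by fun_prop)), ← integral_const_mul]
  simp only [mul_assoc]

/-- Normalised radial factor: testing a product e^{cs} f(θ) against it leaves f alone. -/
theorem exists_testFun_integral_exp (c : ℝ) :
    ∃ ρ : ℝ → ℝ, IsTestOn univ ρ ∧ ∫ s, Real.exp (c * s) * ρ s = 1 := by
  let b : ContDiffBump (0 : ℝ) := ⟨1, 2, one_pos, one_lt_two⟩
  have hb : IsTestOn univ (b.normed volume) :=
    ⟨b.contDiff_normed, b.hasCompactSupport_normed, subset_univ _⟩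
  refine ⟨fun s => Real.exp (-(c * s)) * b.normed volume s, hb.mul_left (by fun_prop), ?_⟩
  simp only [← mul_assoc, ← Real.exp_add]
  simpa using b.integral_normed (μ := volume)

theorem volume_restrict_prod (I : Set ℝ) :
    (volume : Measure (ℝ × ℝ)).restrict (univ ×ˢ I) =
      (volume : Measure ℝ).prod (volume.restrict I) := by
  rw [Measure.volume_eq_prod, ← Measure.prod_restrict, Measure.restrict_univ]

end Tensor

/-! ### Profile, complementarity and energy on the strip -/

section StripAnalysis

variable {a : ℝ} {Q P T : ℝ × ℝ → ℝ}

theorem integrable_tensor_mul {I : Set ℝ} {ρ : ℝ → ℝ} (hρ : Integrable ρ) {f : ℝ → ℝ}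
    (hf : IntegrableOn f I) : IntegrableOn (fun y : ℝ × ℝ => ρ y.1 * f y.2) (univ ×ˢ I) := by
  rw [IntegrableOn, volume_restrict_prod]
  exact hρ.mul_prod hf

theorem integral_tensor_mul (I : Set ℝ) (ρ f : ℝ → ℝ) :
    ∫ y in (univ ×ˢ I : Set (ℝ × ℝ)), ρ y.1 * f y.2 = (∫ s, ρ s) * ∫ t in I, f t := by
  rw [volume_restrict_prod, integral_prod_mul]

/-- A homogeneous function splits as `e^{as} g(θ)`. -/
theorem IsStripSolution.exists_splitting (h : IsStripSolution a Q P T) (hQ : Measurable Q) :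
    ∃ g : ℝ → ℝ, LocallyIntegrableOn g (Ioo (-Real.pi) Real.pi) ∧
      ∀ᵐ y ∂volume.restrict logStrip, Q y = Real.exp (a * y.1) * g y.2 := by
  obtain ⟨ρ, hρ, hρ1⟩ := exists_testFun_integral_exp a
  -- If Q = e^{as} g(θ), integrating against ρ in s recovers g, by the normalisation of ρ.
  refine ⟨fun t => ∫ s, ρ s * Q (s, t), ?_, ?_⟩
  · refine (locallyIntegrableOn_iff isOpen_Ioo.isLocallyClosed).2 fun K hK hKc => ?_
    have h1 : IntegrableOn (fun y => ρ y.1 * Q y) (tsupport ρ ×ˢ K) := by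
      refine IntegrableOn.continuousOn_mul (hρ.smooth.continuous.comp continuous_fst).continuousOn
        (h.locallyIntegrableOn.integrableOn_compact_subset (fun y hy => ?_)
          (hρ.compact_support.isCompact.prod hKc)) (hρ.compact_support.isCompact.prod hKc)
      exact mem_logStrip.2 (hK hy.2)
    have h2 : IntegrableOn (fun y => ρ y.1 * Q y) (univ ×ˢ K) := by
      refine h1.of_forall_sdiff_eq_zero (MeasurableSet.univ.prod hKc.measurableSet) fun y hy => ?_
      rw [image_eq_zero_of_notMem_tsupport fun h' => hy.2 ⟨h', hy.1.2⟩, zero_mul]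
    rw [IntegrableOn, volume_restrict_prod] at h2
    exact h2.integral_prod_right
  · have hm : MeasurableSet {p : ℝ × (ℝ × ℝ) |
        Q (p.2.1 + p.1, p.2.2) = Real.exp (a * p.1) * Q p.2} := by
      refine measurableSet_eq_fun ?_ ?_ <;> fun_prop
    -- Homogeneity holds for a.e. y with a null set depending on τ. Fubini exchanges the
    -- quantifiers, which is where measurability of `Q` enters.
    have h1 := (Measure.ae_ae_comm (μ := (volume : Measure ℝ)) (ν := volume.restrict logStrip)
      (p := fun τ y => Q (y.1 + τ, y.2) = Real.exp (a * τ) * Q y) hm).1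
      (Eventually.of_forall h.homogeneous)
    filter_upwards [h1] with y hy
    have h2 := (measurePreserving_sub_right (volume : Measure ℝ) y.1).quasiMeasurePreserving.ae hy
    have h3 : ∫ s, ρ s * Q (s, y.2) =
        ∫ s, Real.exp (-(a * y.1)) * Q y * (Real.exp (a * s) * ρ s) := by
      refine integral_congr_ae ?_
      filter_upwards [h2] with s hs
      rw [add_sub_cancel] at hs
      rw [hs, mul_sub, sub_eq_add_neg, Real.exp_add]; ring
    rw [h3, integral_const_mul, hρ1, mul_one, ← mul_assoc, ← Real.exp_add]
    simp

theorem upper_subset_logStrip : (univ ×ˢ Ioo 0 Real.pi : Set (ℝ × ℝ)) ⊆ logStrip :=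
  fun y hy => mem_logStrip.2 ⟨by linarith [hy.2.1, Real.pi_pos], hy.2.2⟩

theorem lower_subset_logStrip : (univ ×ˢ Ioo (-Real.pi) 0 : Set (ℝ × ℝ)) ⊆ logStrip :=
  fun y hy => mem_logStrip.2 ⟨hy.2.1, by linarith [hy.2.2, Real.pi_pos]⟩

theorem IsStripSolution.weak_laplace (h : IsStripSolution a Q P T) {Φ : ℝ × ℝ → ℝ}
    (hΦ : IsTestOn (univ ×ˢ Ioo 0 Real.pi) Φ) :
    ∫ y in logStrip, Q y * (fderiv ℝ (fun z => fderiv ℝ Φ z (1, 0)) y (1, 0) +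
      fderiv ℝ (fun z => fderiv ℝ Φ z (0, 1)) y (0, 1)) = 0 := by
  have hΦ' := hΦ.mono upper_subset_logStrip
  have d₁ := hΦ'.fderiv_dir (1, 0)
  have d₂ := hΦ'.fderiv_dir (0, 1)
  have e₁ := h.weak_fst _ d₁
  have e₂ := h.weak_snd _ d₂
  have e₃ := h.harmonic Φ hΦ
  rw [integral_add (d₁.integrable_mul h.locallyIntegrableOn_fst).integrableOn
    (d₂.integrable_mul h.locallyIntegrableOn_snd).integrableOn] at e₃
  simp only [mul_add]
  rw [integral_add ((d₁.fderiv_dir _).integrable_mul h.locallyIntegrableOn).integrableOn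
    ((d₂.fderiv_dir _).integrable_mul h.locallyIntegrableOn).integrableOn, e₁, e₂]
  linarith

/-- The solution is `e^{as}` times a trigonometric profile above the line. -/
theorem IsStripSolution.exists_profile (h : IsStripSolution a Q P T) (hQ : Measurable Q) :
    ∃ A B : ℝ, ∀ᵐ y ∂volume.restrict (univ ×ˢ Ioo 0 Real.pi),
      Q y = Real.exp (a * y.1) * oscProfile a A B y.2 := by
  obtain ⟨g, hg, hQg⟩ := h.exists_splitting hQ
  have hsub : Ioo 0 Real.pi ⊆ Ioo (-Real.pi) Real.pi :=
    Ioo_subset_Ioo_left (by linarith [Real.pi_pos])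
  have hode : ∀ ψ, IsTestOn (Ioo 0 Real.pi) ψ →
      ∫ t, g t * (deriv (deriv ψ) t + a ^ 2 * ψ t) = 0 := by
    intro ψ hψ
    -- Testing with ρ(s)ψ(θ): two integrations by parts give ∫ e^{as}ρ'' = a² ∫ e^{as}ρ = a², so
    -- only the weak oscillator equation for g remains.
    obtain ⟨ρ, hρ, hρ1⟩ := exists_testFun_integral_exp a
    have e := h.weak_laplace (hρ.tensor hψ)
    simp only [fderiv_tensor_fst hρ.differentiable hψ.differentiable,
      fderiv_tensor_snd hρ.differentiable hψ.differentiable,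
      fderiv_tensor_fst hρ.deriv.differentiable hψ.differentiable,
      fderiv_tensor_snd hρ.differentiable hψ.deriv.differentiable] at e
    have i₁ := (hψ.integrable_mul (hg.mono_set hsub))
    have i₂ := (hψ.deriv.deriv.integrable_mul (hg.mono_set hsub))
    have e1 : ∫ y in logStrip, Q y * (deriv (deriv ρ) y.1 * ψ y.2 + ρ y.1 * deriv (deriv ψ) y.2) =
        ∫ y in (univ ×ˢ Ioo (-Real.pi) Real.pi : Set (ℝ × ℝ)),
          ((Real.exp (a * y.1) * deriv (deriv ρ) y.1) * (g y.2 * ψ y.2) +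
          (Real.exp (a * y.1) * ρ y.1) * (g y.2 * deriv (deriv ψ) y.2)) := by
      refine integral_congr_ae ?_
      filter_upwards [hQg] with y hy
      rw [hy]; ring
    rw [e1, integral_add
      (integrable_tensor_mul (ρ := fun s => Real.exp (a * s) * deriv (deriv ρ) s)
        (hρ.deriv.deriv.integrable_continuous_mul (by fun_prop)) i₁.integrableOn)
      (integrable_tensor_mul (ρ := fun s => Real.exp (a * s) * ρ s)
        (hρ.integrable_continuous_mul (by fun_prop)) i₂.integrableOn),
      integral_tensor_mul _ (fun s => Real.exp (a * s) * deriv (deriv ρ) s)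
        (fun t => g t * ψ t),
      integral_tensor_mul _ (fun s => Real.exp (a * s) * ρ s)
        (fun t => g t * deriv (deriv ψ) t), integral_exp_mul_deriv hρ.deriv,
      integral_exp_mul_deriv hρ, hρ1,
      setIntegral_eq_integral_of_forall_compl_eq_zero fun t ht => by
        rw [image_eq_zero_of_notMem_tsupport fun h => ht (hsub (hψ.tsupport_subset h)), mul_zero],
      setIntegral_eq_integral_of_forall_compl_eq_zero fun t ht => by
        rw [image_eq_zero_of_notMem_tsupport fun h => ht (hsub (hψ.deriv.deriv.tsupport_subset h)),
          mul_zero]] at e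
    have i₁' := i₁.const_mul (a ^ 2)
    have : ∀ t, g t * (deriv (deriv ψ) t + a ^ 2 * ψ t) =
        g t * deriv (deriv ψ) t + a ^ 2 * (g t * ψ t) := fun t => by ring
    simp only [this]
    rw [integral_add i₂ i₁', integral_const_mul]
    linarith
  obtain ⟨A, B, hAB⟩ := ae_eq_of_weak_oscillator Real.pi_pos (hg.mono_set hsub) hode
  refine ⟨A, B, ?_⟩
  have h1 : ∀ᵐ y ∂volume.restrict (univ ×ˢ Ioo 0 Real.pi : Set (ℝ × ℝ)),
      g y.2 = oscProfile a A B y.2 := by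
    rw [volume_restrict_prod]
    rw [← ae_restrict_iff' measurableSet_Ioo] at hAB
    exact Measure.quasiMeasurePreserving_snd.ae hAB
  filter_upwards [h1, ae_restrict_of_ae_restrict_of_subset upper_subset_logStrip hQg] with y h1 h2
  rw [h2, h1]

theorem fderiv_exp_mul_fst {k : ℝ → ℝ} (hk : Differentiable ℝ k) (y : ℝ × ℝ) :
    fderiv ℝ (fun y : ℝ × ℝ => Real.exp (a * y.1) * k y.2) y (1, 0) =
      a * Real.exp (a * y.1) * k y.2 := by
  rw [fderiv_tensor_fst (ρ := fun s => Real.exp (a * s)) (by fun_prop) hk]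
  have hd : HasDerivAt (fun s => Real.exp (a * s)) (a * Real.exp (a * y.1)) y.1 := by
    refine (((hasDerivAt_id y.1).const_mul a).exp).congr_deriv ?_
    simp [mul_comm]
  rw [hd.deriv]

/-- The gradient of a solution with a given profile. -/
theorem IsStripSolution.ae_grad_eq (h : IsStripSolution a Q P T) {I : Set ℝ} (hI : IsOpen I)
    (hsub : univ ×ˢ I ⊆ logStrip) {A B : ℝ}
    (hQ : ∀ᵐ y ∂volume.restrict (univ ×ˢ I), Q y = Real.exp (a * y.1) * oscProfile a A B y.2) :
    ∀ᵐ y ∂volume.restrict (univ ×ˢ I), P y = a * Real.exp (a * y.1) * oscProfile a A B y.2 ∧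
      T y = Real.exp (a * y.1) * oscProfile a B (-(a ^ 2 * A)) y.2 := by
  have hp := contDiff_oscProfile a A B
  have hR : ContDiff ℝ ∞ (fun y : ℝ × ℝ => Real.exp (a * y.1) * oscProfile a A B y.2) := by
    fun_prop
  filter_upwards [ae_eq_fderiv_of_weak (isOpen_univ.prod hI) isOpen_logStrip.measurableSet hsub
    h.locallyIntegrableOn_fst hR hQ h.weak_fst, ae_eq_fderiv_of_weak (isOpen_univ.prod hI)
    isOpen_logStrip.measurableSet hsub h.locallyIntegrableOn_snd hR hQ h.weak_snd] with y h1 h2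
  have hd : Differentiable ℝ (oscProfile a A B) := hp.differentiable (by simp)
  rw [fderiv_exp_mul_fst hd] at h1
  rw [fderiv_tensor_snd (ρ := fun s => Real.exp (a * s)) (by fun_prop) hd,
    (hasDerivAt_oscProfile a A B y.2).deriv] at h2
  exact ⟨h1, h2⟩

/-- Integration of the complementarity form over a strip on which the solution is smooth. -/
theorem IsStripSolution.integral_form (h : IsStripSolution a Q P T) {α β : ℝ} (hαβ : α ≤ β)
    (hsub : univ ×ˢ Ioo α β ⊆ logStrip) {A B : ℝ}
    (hQ : ∀ᵐ y ∂volume.restrict (univ ×ˢ Ioo α β),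
      Q y = Real.exp (a * y.1) * oscProfile a A B y.2)
    {ρ ψ : ℝ → ℝ} (hρ : IsTestOn univ ρ) (hψ : IsTestOn univ ψ)
    (hρ1 : ∫ s, Real.exp (2 * a * s) * ρ s = 1) :
    IntegrableOn (fun y : ℝ × ℝ => ρ y.1 * ψ y.2 * (P y ^ 2 + T y ^ 2) +
      Q y * (P y * (deriv ρ y.1 * ψ y.2) + T y * (ρ y.1 * deriv ψ y.2))) (univ ×ˢ Ioo α β) ∧
    ∫ y in (univ ×ˢ Ioo α β : Set (ℝ × ℝ)), (ρ y.1 * ψ y.2 * (P y ^ 2 + T y ^ 2) +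
      Q y * (P y * (deriv ρ y.1 * ψ y.2) + T y * (ρ y.1 * deriv ψ y.2))) =
      ψ β * (oscProfile a A B β * oscProfile a B (-(a ^ 2 * A)) β) -
      ψ α * (oscProfile a A B α * oscProfile a B (-(a ^ 2 * A)) α) := by
  set k := oscProfile a A B with hk
  set k' := oscProfile a B (-(a ^ 2 * A)) with hk'
  have ck : Continuous k := (contDiff_oscProfile a A B).continuous
  have ck' : Continuous k' := (contDiff_oscProfile a _ _).continuous
  have cψ := hψ.smooth.continuous
  have cψ' := hψ.deriv.smooth.continuous
  set f₁ : ℝ → ℝ := fun t => ψ t * (a ^ 2 * k t ^ 2 + k' t ^ 2) + k t * k' t * deriv ψ t with hf₁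
  set f₂ : ℝ → ℝ := fun t => a * k t ^ 2 * ψ t with hf₂
  have c₁ : Continuous f₁ := by fun_prop
  have c₂ : Continuous f₂ := by fun_prop
  have hae : (fun y : ℝ × ℝ => ρ y.1 * ψ y.2 * (P y ^ 2 + T y ^ 2) +
      Q y * (P y * (deriv ρ y.1 * ψ y.2) + T y * (ρ y.1 * deriv ψ y.2)))
      =ᵐ[volume.restrict (univ ×ˢ Ioo α β)] fun y =>
      (Real.exp (2 * a * y.1) * ρ y.1) * f₁ y.2 + (Real.exp (2 * a * y.1) * deriv ρ y.1) * f₂ y.2 := by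
    filter_upwards [hQ, h.ae_grad_eq isOpen_Ioo hsub hQ] with y h1 h2
    have e : Real.exp (2 * a * y.1) = Real.exp (a * y.1) * Real.exp (a * y.1) := by
      rw [← Real.exp_add]; ring_nf
    rw [h1, h2.1, h2.2, e]
    simp only [hf₁, hf₂, hk, hk']
    ring
  have i₁ : IntegrableOn (fun y : ℝ × ℝ => (Real.exp (2 * a * y.1) * ρ y.1) * f₁ y.2)
      (univ ×ˢ Ioo α β) :=
    integrable_tensor_mul (ρ := fun s => Real.exp (2 * a * s) * ρ s)
      (hρ.integrable_continuous_mul (by fun_prop))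
      (c₁.integrableOn_Icc.mono_set Ioo_subset_Icc_self)
  have i₂ : IntegrableOn (fun y : ℝ × ℝ => (Real.exp (2 * a * y.1) * deriv ρ y.1) * f₂ y.2)
      (univ ×ˢ Ioo α β) :=
    integrable_tensor_mul (ρ := fun s => Real.exp (2 * a * s) * deriv ρ s)
      (hρ.deriv.integrable_continuous_mul (by fun_prop))
      (c₂.integrableOn_Icc.mono_set Ioo_subset_Icc_self)
  refine ⟨(i₁.add i₂).congr hae.symm, ?_⟩
  rw [integral_congr_ae hae, integral_add i₁ i₂,
    integral_tensor_mul _ (fun s => Real.exp (2 * a * s) * ρ s) f₁,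
    integral_tensor_mul _ (fun s => Real.exp (2 * a * s) * deriv ρ s) f₂,
    integral_exp_mul_deriv hρ, hρ1, ← integral_Ioc_eq_integral_Ioo,
    ← integral_Ioc_eq_integral_Ioo, ← intervalIntegral.integral_of_le hαβ,
    ← intervalIntegral.integral_of_le hαβ, one_mul, ← intervalIntegral.integral_const_mul,
    ← intervalIntegral.integral_add (c₁.intervalIntegrable _ _)
      ((c₂.intervalIntegrable _ _).const_mul _)]
  -- Since ∫ e^{2as}ρ' = -2a, the angular integrand is f₁ - 2a f₂ = ψ(k'² - a²k²) + ψ'kk'. This is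
  -- (ψkk')' because k'' = -a²k.
  refine intervalIntegral.integral_eq_sub_of_hasDerivAt (f := fun t => ψ t * (k t * k' t))
    (fun t _ => ?_) (Continuous.intervalIntegrable (by fun_prop) _ _)
  refine ((hψ.differentiable t).hasDerivAt.mul ((hasDerivAt_oscProfile a A B t).mul
    (hasDerivAt_oscProfile a B (-(a ^ 2 * A)) t))).congr_deriv ?_
  simp only [hf₁, hf₂, hk, hk', Pi.mul_apply]
  unfold oscProfile
  ring

theorem exists_testFun_bump : ∃ ψ : ℝ → ℝ, IsTestOn (Ioo (-Real.pi) Real.pi) ψ ∧ ψ 0 = 1 := by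
  let b : ContDiffBump (0 : ℝ) := ⟨1, 2, one_pos, one_lt_two⟩
  refine ⟨b, ⟨b.contDiff, b.hasCompactSupport, ?_⟩,
    b.one_of_mem_closedBall (Metric.mem_closedBall_self zero_le_one)⟩
  rw [b.tsupport_eq, Real.closedBall_eq_Icc]
  intro t ht
  have : (2 : ℝ) < Real.pi := by linarith [Real.pi_gt_three]
  have h1 : b.rOut = 2 := rfl
  rw [h1] at ht
  exact ⟨by linarith [ht.1], by linarith [ht.2]⟩

theorem logStrip_ae_eq : (logStrip : Set (ℝ × ℝ)) =ᵐ[volume]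
    (univ ×ˢ Ioo (-Real.pi) 0 ∪ univ ×ˢ Ioo 0 Real.pi : Set (ℝ × ℝ)) := by
  have h0 : ∀ᵐ y : ℝ × ℝ, y.2 ≠ 0 := by
    rw [Measure.volume_eq_prod]
    exact Measure.quasiMeasurePreserving_snd.ae (Measure.ae_ne volume (0 : ℝ))
  refine eventuallyEq_set.2 ?_
  filter_upwards [h0] with y hy
  simp only [mem_logStrip, mem_union, mem_prod, mem_univ, true_and, mem_Ioo]
  constructor
  · rintro ⟨h1, h2⟩
    rcases lt_or_gt_of_ne hy with h3 | h3
    · exact Or.inl ⟨h1, h3⟩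
    · exact Or.inr ⟨h3, h2⟩
  · rintro (⟨h1, h2⟩ | ⟨h1, h2⟩)
    · exact ⟨h1, h2.trans Real.pi_pos⟩
    · exact ⟨by linarith [Real.pi_pos], h2⟩

theorem measurePreserving_neg_snd :
    MeasurePreserving (fun y : ℝ × ℝ => (y.1, -y.2)) :=
  (MeasurePreserving.id volume).prod (Measure.measurePreserving_neg volume)

theorem IsStripSolution.ae_lower (h : IsStripSolution a Q P T) {A B : ℝ}
    (hQ : ∀ᵐ y ∂volume.restrict (univ ×ˢ Ioo 0 Real.pi),
      Q y = Real.exp (a * y.1) * oscProfile a A B y.2) :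
    ∀ᵐ y ∂volume.restrict (univ ×ˢ Ioo (-Real.pi) 0),
      Q y = Real.exp (a * y.1) * oscProfile a A (-B) y.2 := by
  have hmu : MeasurableSet (univ ×ˢ Ioo 0 Real.pi : Set (ℝ × ℝ)) :=
    MeasurableSet.univ.prod measurableSet_Ioo
  have hml : MeasurableSet (univ ×ˢ Ioo (-Real.pi) 0 : Set (ℝ × ℝ)) :=
    MeasurableSet.univ.prod measurableSet_Ioo
  have h1 := ae_restrict_of_ae_restrict_of_subset lower_subset_logStrip h.even
  rw [ae_restrict_iff' hmu] at hQ
  rw [ae_restrict_iff' hml] at h1 ⊢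
  filter_upwards [h1, measurePreserving_neg_snd.quasiMeasurePreserving.ae hQ] with y h2 h3 hy
  rw [← h2 hy, h3 ⟨mem_univ _, by simpa using hy.2.2, by simpa using neg_lt.1 hy.2.1⟩,
    oscProfile_neg]

/-- The complementarity condition `q Δq = 0` on the positive half-line. -/
theorem IsStripSolution.mul_eq_zero (h : IsStripSolution a Q P T) {A B : ℝ}
    (hQ : ∀ᵐ y ∂volume.restrict (univ ×ˢ Ioo 0 Real.pi),
      Q y = Real.exp (a * y.1) * oscProfile a A B y.2) : A * B = 0 := by
  obtain ⟨ρ, hρ, hρ1⟩ := exists_testFun_integral_exp (2 * a)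
  obtain ⟨ψ, hψ, hψ0⟩ := exists_testFun_bump
  have hψ' := hψ.mono (subset_univ _)
  have e := h.complementarity _ (hρ.tensor hψ)
  simp only [fderiv_tensor_fst hρ.differentiable hψ.differentiable,
    fderiv_tensor_snd hρ.differentiable hψ.differentiable] at e
  obtain ⟨i₁, e₁⟩ := h.integral_form Real.pi_pos.le upper_subset_logStrip hQ hρ hψ' hρ1
  obtain ⟨i₂, e₂⟩ := h.integral_form (by linarith [Real.pi_pos]) lower_subset_logStrip
    (h.ae_lower hQ) hρ hψ' hρ1
  have hd : Disjoint (univ ×ˢ Ioo (-Real.pi) 0 : Set (ℝ × ℝ)) (univ ×ˢ Ioo 0 Real.pi) := by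
    rw [Set.disjoint_left]
    intro y h1 h2
    exact lt_asymm h1.2.2 h2.2.1
  rw [setIntegral_congr_set logStrip_ae_eq, setIntegral_union hd
    (MeasurableSet.univ.prod measurableSet_Ioo) i₂ i₁, e₁, e₂] at e
  have z₁ : ψ Real.pi = 0 :=
    image_eq_zero_of_notMem_tsupport fun h => lt_irrefl _ (hψ.tsupport_subset h).2
  have z₂ : ψ (-Real.pi) = 0 :=
    image_eq_zero_of_notMem_tsupport fun h => lt_irrefl _ (hψ.tsupport_subset h).1
  -- Only the boundary terms at θ = 0 survive: each side contributes -AB, the lower one through its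
  -- coefficient -B, so -2AB = 0.
  simp only [z₁, z₂, hψ0, oscProfile_zero] at e
  linarith

/-- Finiteness of the energy near the origin. -/
theorem IsStripSolution.energy_eq_zero (h : IsStripSolution a Q P T) {A B : ℝ}
    (hQ : ∀ᵐ y ∂volume.restrict (univ ×ˢ Ioo 0 Real.pi),
      Q y = Real.exp (a * y.1) * oscProfile a A B y.2) (ha : a ≤ 0) :
    a ^ 2 * A ^ 2 + B ^ 2 = 0 := by
  have hm : MeasurableSet (Iic 0 ×ˢ Ioo 0 Real.pi : Set (ℝ × ℝ)) :=
    measurableSet_Iic.prod measurableSet_Ioo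
  have hsub : (Iic 0 ×ˢ Ioo 0 Real.pi : Set (ℝ × ℝ)) ⊆ univ ×ˢ Ioo 0 Real.pi :=
    prod_mono (subset_univ _) le_rfl
  have h1 := ae_restrict_of_ae_restrict_of_subset hsub
    (h.ae_grad_eq isOpen_Ioo upper_subset_logStrip hQ)
  -- For a ≤ 0 and s ≤ 0 the factor e^{2as} is at least 1, so the conserved energy is a constant
  -- dominated by an integrable function on a set of infinite measure.
  have h2 : IntegrableOn (fun _ : ℝ × ℝ => a ^ 2 * A ^ 2 + B ^ 2) (Iic 0 ×ˢ Ioo 0 Real.pi) := by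
    refine Integrable.mono' h.energy aestronglyMeasurable_const ?_
    filter_upwards [h1, ae_restrict_mem hm] with y hy hmem
    have hexp : 1 ≤ Real.exp (a * y.1) := Real.one_le_exp (mul_nonneg_of_nonpos_of_nonpos ha hmem.1)
    have hE := oscProfile_energy a A B y.2
    have hnn : 0 ≤ a ^ 2 * A ^ 2 + B ^ 2 := by positivity
    rw [Real.norm_of_nonneg hnn, hy.1, hy.2]
    calc a ^ 2 * A ^ 2 + B ^ 2 ≤ Real.exp (a * y.1) ^ 2 * (a ^ 2 * A ^ 2 + B ^ 2) :=
          le_mul_of_one_le_left hnn (one_le_pow₀ hexp)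
      _ = _ := by rw [← hE]; ring
  rw [integrableOn_const_iff] at h2
  rcases h2 with h2 | h2
  · simpa using h2
  · rw [Measure.volume_eq_prod, Measure.prod_prod, Real.volume_Iic, Real.volume_Ioo] at h2
    rw [ENNReal.top_mul (by simp [Real.pi_pos])] at h2
    exact absurd h2 (lt_irrefl _)

end StripAnalysis

/-! ### Invariance under change of representative -/

section MeasurableRepresentative

variable {n : ℕ} {q q' : EuclideanSpace ℝ (Fin n) → ℝ}

theorem LocallyL2.congr (h : LocallyL2 q) (e : q =ᵐ[volume] q') : LocallyL2 q' :=
  fun K hK => (memLp_congr_ae (ae_restrict_of_ae e)).1 (h K hK)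

theorem IsLocalSobolev.congr {G : EuclideanSpace ℝ (Fin n) → EuclideanSpace ℝ (Fin n)}
    (h : IsLocalSobolev q G) (e : q =ᵐ[volume] q') : IsLocalSobolev q' G where
  memL2 := h.memL2.congr e
  grad_memL2 := h.grad_memL2
  weak_grad φ hφ v := by
    rw [← h.weak_grad φ hφ v]
    refine integral_congr_ae ?_
    filter_upwards [e] with x hx
    rw [hx]

theorem distLaplacian_congr (e : q =ᵐ[volume] q') (φ : EuclideanSpace ℝ (Fin n) → ℝ) :
    distLaplacian q φ = distLaplacian q' φ := by
  refine integral_congr_ae ?_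
  filter_upwards [e] with x hx
  rw [hx]

theorem distMulLaplacian_congr (e : q =ᵐ[volume] q')
    (G : EuclideanSpace ℝ (Fin n) → EuclideanSpace ℝ (Fin n))
    (φ : EuclideanSpace ℝ (Fin n) → ℝ) :
    distMulLaplacian q G φ = distMulLaplacian q' G φ := by
  unfold distMulLaplacian
  congr 1
  refine integral_congr_ae ?_
  filter_upwards [e] with x hx
  rw [hx]

theorem IsHomogeneousOfDegree.congr {a : ℝ} (h : IsHomogeneousOfDegree a q)
    (e : q =ᵐ[volume] q') : IsHomogeneousOfDegree a q' := by
  intro t ht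
  have hm : Measure.QuasiMeasurePreserving (fun x : EuclideanSpace ℝ (Fin n) => t • x) := by
    refine ⟨by fun_prop, ?_⟩
    rw [Measure.map_addHaar_smul _ ht.ne']
    exact Measure.smul_absolutelyContinuous
  filter_upwards [h t ht, e, hm.ae e] with x h1 h2 h3
  rw [← h2, ← h3, h1]

theorem IsEvenSymmetric.congr {L : Submodule ℝ (EuclideanSpace ℝ (Fin n))}
    (h : IsEvenSymmetric L q) (e : q =ᵐ[volume] q') : IsEvenSymmetric L q' := by
  filter_upwards [h, e, L.reflection.measurePreserving.quasiMeasurePreserving.ae e]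
    with x h1 h2 h3
  rw [← h2, ← h3, h1]

end MeasurableRepresentative

/-! ### The two half-lines and the conclusion -/

/-- A Euclidean plane can be identified with `ℂ` so that a given line becomes the real axis. -/
theorem exists_isometry_complex {L : Submodule ℝ 𝔼} (hL : Module.finrank ℝ L = 1) :
    ∃ Ψ : 𝔼 ≃ₗᵢ[ℝ] ℂ, ∀ x, x ∈ L ↔ (Ψ x).im = 0 := by
  obtain ⟨u, hu⟩ : ∃ u : L, ‖u‖ = 1 := by
    have : Nontrivial L := Module.nontrivial_of_finrank_pos (R := ℝ) (by omega)
    exact exists_norm_eq L zero_le_one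
  replace hu : ‖(u : 𝔼)‖ = 1 := hu
  have hspan : L = Submodule.span ℝ {(u : 𝔼)} := by
    refine (Submodule.eq_of_le_of_finrank_eq ?_ ?_).symm
    · exact (Submodule.span_singleton_le_iff_mem _ _).2 u.2
    · rw [hL, finrank_span_singleton]
      intro h
      rw [h, norm_zero] at hu
      exact zero_ne_one hu
  have ho : Orthonormal ℝ (({(0 : Fin 2)} : Set (Fin 2)).domRestrict fun _ => (u : 𝔼)) := by
    refine ⟨fun _ => hu, fun i j hij => ?_⟩
    exact absurd (Subsingleton.elim i j) hij
  obtain ⟨b, hb⟩ := ho.exists_orthonormalBasis_extension_of_card_eq (by simp)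
  have hb0 : b 0 = u := hb 0 rfl
  have him : ∀ x, ((b.repr.trans Complex.orthonormalBasisOneI.repr.symm) x).im = b.repr x 1 := by
    intro x
    rw [LinearIsometryEquiv.trans_apply, ← OrthonormalBasis.sum_repr_symm]
    simp [Fin.sum_univ_two]
  refine ⟨b.repr.trans Complex.orthonormalBasisOneI.repr.symm, fun x => ?_⟩
  rw [him, hspan, Submodule.mem_span_singleton, ← hb0]
  constructor
  · rintro ⟨c, rfl⟩
    simp
  · intro h
    refine ⟨b.repr x 0, ?_⟩
    conv_rhs => rw [← b.sum_repr x, Fin.sum_univ_two, h]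
    simp

/-- The reflection of the complex plane across the imaginary axis. -/
noncomputable def reflectRe : ℂ ≃ₗᵢ[ℝ] ℂ := Complex.conjLIE.trans (LinearIsometryEquiv.neg ℝ)

theorem reflectRe_apply (z : ℂ) : reflectRe z = -(starRingEnd ℂ z) := rfl

/-- The reflection of e^{s+iθ} across the imaginary axis is e^{s+i(π-θ)}. The mirrored chart thus
places the negative half-line at angle 0, inside its strip. -/
theorem logChart_reflectRe (Ψ : 𝔼 ≃ₗᵢ[ℝ] ℂ) (y : ℝ × ℝ) :
    logChart (Ψ.trans reflectRe) (y.1, Real.pi - y.2) = logChart Ψ y := by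
  apply (Ψ.trans reflectRe).injective
  rw [apply_logChart, LinearIsometryEquiv.trans_apply, apply_logChart, reflectRe_apply,
    ← Complex.exp_conj]
  have : ((y.1, Real.pi - y.2).1 : ℂ) + ((y.1, Real.pi - y.2).2 : ℝ) * Complex.I =
      (starRingEnd ℂ (y.1 + y.2 * Complex.I)) + Real.pi * Complex.I := by
    simp; ring
  rw [this, Complex.exp_add, Complex.exp_pi_mul_I, mul_neg_one]

/-- The two profiles agree a.e. after θ ↦ π - θ, hence by continuity on all of [0, π]. Comparing
values and derivatives at π yields the new coefficients. -/
theorem oscProfile_eqOn_unique {a A B A' B' : ℝ} {Q Q' : ℝ × ℝ → ℝ}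
    (hQ : ∀ᵐ y ∂volume.restrict (univ ×ˢ Ioo 0 Real.pi),
      Q y = Real.exp (a * y.1) * oscProfile a A B y.2)
    (hQ' : ∀ᵐ y ∂volume.restrict (univ ×ˢ Ioo 0 Real.pi),
      Q' y = Real.exp (a * y.1) * oscProfile a A' B' y.2)
    (e : ∀ y : ℝ × ℝ, Q' (y.1, Real.pi - y.2) = Q y) :
    A' = oscProfile a A B Real.pi ∧ B' = -oscProfile a B (-(a ^ 2 * A)) Real.pi := by
  have hmu : MeasurableSet (univ ×ˢ Ioo 0 Real.pi : Set (ℝ × ℝ)) :=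
    MeasurableSet.univ.prod measurableSet_Ioo
  have hmp : MeasurePreserving (fun y : ℝ × ℝ => (y.1, Real.pi - y.2)) :=
    (MeasurePreserving.id volume).prod (Measure.measurePreserving_sub_left volume Real.pi)
  have h1 : ∀ᵐ y ∂volume.restrict (univ ×ˢ Ioo 0 Real.pi : Set (ℝ × ℝ)),
      oscProfile a A' B' (Real.pi - y.2) = oscProfile a A B y.2 := by
    rw [ae_restrict_iff' hmu] at hQ hQ' ⊢
    filter_upwards [hQ, hmp.quasiMeasurePreserving.ae hQ'] with y h1 h2 hy
    have h3 := h2 ⟨mem_univ _, by simpa using hy.2.2, by simpa using hy.2.1⟩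
    rw [e, h1 hy] at h3
    exact (mul_left_cancel₀ (Real.exp_pos _).ne' h3).symm
  have c := (contDiff_oscProfile a A B).continuous
  have c' := (contDiff_oscProfile a A' B').continuous
  have h2 : EqOn (fun y : ℝ × ℝ => oscProfile a A' B' (Real.pi - y.2))
      (fun y => oscProfile a A B y.2) (univ ×ˢ Ioo 0 Real.pi) :=
    Measure.eqOn_open_of_ae_eq h1 (isOpen_univ.prod isOpen_Ioo)
      (by fun_prop) (by fun_prop)
  have h3 : EqOn (fun t => oscProfile a A' B' (Real.pi - t)) (oscProfile a A B)
      (Icc 0 Real.pi) := by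
    rw [← closure_Ioo Real.pi_pos.ne]
    exact EqOn.closure (fun t ht => h2 (x := (0, t)) ⟨mem_univ _, ht⟩) (by fun_prop) c
  have h4 := h3 (right_mem_Icc.2 Real.pi_pos.le)
  simp only [sub_self, oscProfile_zero] at h4
  refine ⟨h4, ?_⟩
  have d1 : HasDerivAt (fun t => oscProfile a A' B' (Real.pi - t)) (-B') Real.pi := by
    have := (hasDerivAt_oscProfile a A' B' (Real.pi - Real.pi)).comp Real.pi
      ((hasDerivAt_id Real.pi).const_sub Real.pi)
    simpa [oscProfile_zero] using! this
  have d2 := hasDerivAt_oscProfile a A B Real.pi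
  -- Agreement is known only on [0, π], so one-sided derivatives are compared at π.
  have hu : UniqueDiffWithinAt ℝ (Icc 0 Real.pi) Real.pi :=
    uniqueDiffOn_Icc Real.pi_pos _ (right_mem_Icc.2 Real.pi_pos.le)
  have d3 := d1.hasDerivWithinAt (s := Icc 0 Real.pi)
  have d4 := (d2.hasDerivWithinAt (s := Icc 0 Real.pi)).congr h3 (h3 (right_mem_Icc.2 Real.pi_pos.le))
  have := hu.eq_deriv _ d3 d4
  linarith

theorem half_integer_of_sin_two_mul {a : ℝ} (ha : 0 < a) (h : Real.sin (2 * (a * Real.pi)) = 0) :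
    ∃ k : ℕ, 1 ≤ k ∧ a = (k : ℝ) / 2 := by
  obtain ⟨m, hm⟩ := Real.sin_eq_zero_iff.1 h
  have h1 : (m : ℝ) = 2 * a := by
    have : (m : ℝ) * Real.pi = 2 * a * Real.pi := by rw [hm]; ring
    exact mul_right_cancel₀ Real.pi_pos.ne' this
  have h2 : 0 < m := by
    have : (0 : ℝ) < m := by rw [h1]; positivity
    exact_mod_cast this
  refine ⟨m.toNat, by omega, ?_⟩
  have h3 : ((m.toNat : ℕ) : ℝ) = (m : ℝ) := by
    exact_mod_cast congrArg (Int.cast (R := ℝ)) (Int.toNat_of_nonneg h2.le)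
  rw [h3, h1]; ring

/-- The two complementarity conditions, at both ends of the half-circle, force `a ∈ ℤ/2`. -/
theorem sin_two_mul_eq_zero {a A B : ℝ} (ha : a ≠ 0) (hne : A ≠ 0 ∨ B ≠ 0) (h0 : A * B = 0)
    (hπ : oscProfile a A B Real.pi * -oscProfile a B (-(a ^ 2 * A)) Real.pi = 0) :
    Real.sin (2 * (a * Real.pi)) = 0 := by
  have hs := mul_oscSin a Real.pi
  rw [Real.sin_two_mul, ← hs]
  unfold oscProfile at hπ
  -- If A = 0 then kk' = B² s cos(aθ), with s = `oscSin a`; if B = 0 then kk' = -a²A² s cos(aθ).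
  -- Either way s(π) cos(aπ) = 0.
  rcases mul_eq_zero.1 h0 with h | h
  · have hB : B ≠ 0 := by simpa [h] using hne
    subst h
    have : B ^ 2 * (oscSin a Real.pi * Real.cos (a * Real.pi)) = 0 := by linear_combination -hπ
    have := (mul_eq_zero.1 this).resolve_left (pow_ne_zero 2 hB)
    linear_combination 2 * a * this
  · have hA : A ≠ 0 := by simpa [h] using hne
    subst h
    have : (a ^ 2 * A ^ 2) * (oscSin a Real.pi * Real.cos (a * Real.pi)) = 0 := by
      linear_combination hπ
    have := (mul_eq_zero.1 this).resolve_left (by positivity)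
    linear_combination 2 * a * this

theorem IsStripSolution.ae_const {a : ℝ} {Q P T : ℝ × ℝ → ℝ} (h : IsStripSolution a Q P T)
    {A B : ℝ} {c : ℝ}
    (hQ : ∀ᵐ y ∂volume.restrict (univ ×ˢ Ioo 0 Real.pi),
      Q y = Real.exp (a * y.1) * oscProfile a A B y.2)
    (hup : ∀ y : ℝ × ℝ, Real.exp (a * y.1) * oscProfile a A B y.2 = c)
    (hlow : ∀ y : ℝ × ℝ, Real.exp (a * y.1) * oscProfile a A (-B) y.2 = c) :
    ∀ᵐ y ∂volume.restrict logStrip, Q y = c := by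
  rw [Measure.restrict_congr_set logStrip_ae_eq, ae_restrict_union_iff]
  refine ⟨?_, ?_⟩
  · filter_upwards [h.ae_lower hQ] with y hy
    rw [hy, hlow]
  · filter_upwards [hQ] with y hy
    rw [hy, hup]

theorem homogeneous_solution_of_measurable {L : Submodule ℝ 𝔼} (hL : Module.finrank ℝ L = 1)
    {q : 𝔼 → ℝ} (hm : Measurable q) (hq0 : ¬ ∀ᵐ x, q x = 0) {G : 𝔼 → 𝔼}
    (h : IsLocalSobolev q G) (hc : ∀ φ, IsTestFun φ → distMulLaplacian q G φ = 0)
    (hΔ : ∀ φ, IsTestFun φ → tsupport φ ⊆ (L : Set 𝔼)ᶜ → distLaplacian q φ = 0)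
    (heven : IsEvenSymmetric L q) {a : ℝ} (hhom : IsHomogeneousOfDegree a q) :
    (∃ k : ℕ, 1 ≤ k ∧ a = (k : ℝ) / 2) ∨ (a = 0 ∧ ∃ c : ℝ, ∀ᵐ x, q x = c) := by
  obtain ⟨Ψ, hΨ⟩ := exists_isometry_complex hL
  have hΨ' : ∀ x, x ∈ L ↔ ((Ψ.trans reflectRe) x).im = 0 := fun x => by
    simp [hΨ, reflectRe_apply]
  have S := isStripSolution_logChart Ψ hΨ h hc hΔ heven hhom
  have S' := isStripSolution_logChart (Ψ.trans reflectRe) hΨ' h hc hΔ heven hhom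
  obtain ⟨A, B, hAB⟩ := S.exists_profile (hm.comp (continuous_logChart _).measurable)
  obtain ⟨A', B', hAB'⟩ := S'.exists_profile (hm.comp (continuous_logChart _).measurable)
  have hconst : ∀ c : ℝ, (∀ y : ℝ × ℝ, Real.exp (a * y.1) * oscProfile a A B y.2 = c) →
      (∀ y : ℝ × ℝ, Real.exp (a * y.1) * oscProfile a A (-B) y.2 = c) → ∀ᵐ x, q x = c :=
    fun c h1 h2 => (ae_logChart_iff Ψ (p := fun x => q x = c)
      (measurableSet_eq_fun hm measurable_const)).2 (S.ae_const hAB h1 h2)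
  have hne : A ≠ 0 ∨ B ≠ 0 := by
    by_contra! hcon
    exact hq0 (hconst 0 (by simp [hcon, oscProfile]) (by simp [hcon, oscProfile]))
  -- The product of the coefficients in the mirrored chart is now -k(π)k'(π), so its complementarity
  -- is the condition on the negative half-line.
  obtain ⟨rfl, rfl⟩ := oscProfile_eqOn_unique hAB hAB'
    fun y => congrArg q (logChart_reflectRe Ψ y)
  rcases lt_trichotomy a 0 with ha | ha | ha
  · exfalso
    have hE := S.energy_eq_zero hAB ha.le
    have hB : B = 0 := by
      have : B ^ 2 = 0 := le_antisymm (by nlinarith [mul_nonneg (sq_nonneg a) (sq_nonneg A)])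
        (sq_nonneg B)
      simpa using this
    have hA : A = 0 := by simpa [hB, ha.ne] using hE
    exact hne.elim (fun h => h hA) fun h => h hB
  · right
    have hE := S.energy_eq_zero hAB ha.le
    have hB : B = 0 := by simpa [ha] using hE
    exact ⟨ha, A, hconst A (by simp [ha, hB, oscProfile]) (by simp [ha, hB, oscProfile])⟩
  · left
    exact half_integer_of_sin_two_mul ha
      (sin_two_mul_eq_zero ha.ne' hne (S.mul_eq_zero hAB) (S'.mul_eq_zero hAB'))

theorem mainTheorem8 (L : Submodule ℝ (EuclideanSpace ℝ (Fin 2)))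
    (hL : Module.finrank ℝ L = 1) (q : EuclideanSpace ℝ (Fin 2) → ℝ)
    (hq0 : ¬ ∀ᵐ x, q x = 0) (hq : IsNoSignThinSolution L q) (heven : IsEvenSymmetric L q)
    (a : ℝ) (hhom : IsHomogeneousOfDegree a q) :
    (∃ k : ℕ, 1 ≤ k ∧ a = (k : ℝ) / 2) ∨ (a = 0 ∧ ∃ c : ℝ, ∀ᵐ x, q x = c) := by
  obtain ⟨G, h, -, hc, hΔ⟩ := hq
  -- All hypotheses are insensitive to null sets, so q may be replaced by a Borel representative, as
  -- Fubini and the transfer of null sets through the chart require.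
  have hmeas := h.memL2.locallyIntegrable.aestronglyMeasurable.aemeasurable
  have e : q =ᵐ[volume] hmeas.mk q := hmeas.ae_eq_mk
  have key := homogeneous_solution_of_measurable hL hmeas.measurable_mk
    (fun h0 => hq0 (by filter_upwards [e, h0] with x h1 h2; rw [h1, h2])) (h.congr e)
    (fun φ hφ => by rw [← distMulLaplacian_congr e]; exact hc φ hφ)
    (fun φ hφ hs => by rw [← distLaplacian_congr e]; exact hΔ φ hφ hs)
    (heven.congr e) (hhom.congr e)
  refine key.imp id fun ⟨ha, c, hcc⟩ => ⟨ha, c, ?_⟩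
  filter_upwards [e, hcc] with x h1 h2
  rw [h1, h2]
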